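/- Let $\beta > \frac{\pi}{2}$ and let $\phi:\mathbb R\to\mathbb R$ be a smooth, even, convex function with $\phi\ge 0$, such that $\phi^{-1}(0)=[-(\beta-\frac{\pi}{2}),\,\beta-\frac{\pi}{2}]$, such that for some $a>0$ one has $\phi(x)>1$ whenever $|x|>a$, and such that $\phi'(x)\neq 0$ whenever $\phi(x)=1$. Let $$\Omega_\beta=\left\{(z,w)\in\mathbb C^2 : w\neq 0,\ \left|z-e^{i\log|w|^2}\right|^2-\left(1-\phi(\log|w|^2)\right)<0\right\}$$ be the associated worm domain. For a set $\Omega\subset\mathbb C^2$, a defining function of $\Omega$ is a smooth ($C^\infty$) function $\rho:V\to\mathbb R$ on an open neighborhood $V$ of $\overline\Omega$ such that $\Omega=\{p\in V:\rho(p)<0\}$ and $d\rho(p)\neq 0$ for all $p\in\partial\Omega$. The Steinness exponent $\widetilde\eta_\rho\in[1,\infty]$ of $\rho$ is the infimum of all real $\eta>1$ for which there is an open neighborhood $U\subset V$ of $\partial\Omega$ such that $\rho^{\eta}$ is strictly plurisubharmonic on $U\setminus\overline\Omega$ (that is, $\rho^\eta$ is $C^2$ with positive definite complex Hessian there); $\widetilde\eta_\rho=\infty$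 if there is no such $\eta$. The Steinness index of $\Omega$ is $S(\Omega)=\inf_\rho\widetilde\eta_\rho$, the infimum being over all defining functions $\rho$ of $\Omega$. Then $$S(\Omega_\beta)=\begin{cases}\dfrac{\pi}{2(\pi-\beta)} & \text{if } \frac{\pi}{2}<\beta<\pi,\\[2mm] \infty & \text{if } \beta\ge\pi.\end{cases}$$ -/

import Mathlib

open Set Real
open scoped ContDiff

/-- The Levi form (complex Hessian) of a real function `f` on `ℂ²` at `p` in the direction `v`,
`∑ j k, (∂²f / ∂z_j ∂z̄_k)(p) v_j conj(v_k)`, written through the real second derivative as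
`(D²f(p)(v, v) + D²f(p)(iv, iv)) / 4`. -/
noncomputable def leviForm (f : ℂ × ℂ → ℝ) (p v : ℂ × ℂ) : ℝ :=
  (fderiv ℝ (fderiv ℝ f) p v v
    + fderiv ℝ (fderiv ℝ f) p (Complex.I • v) (Complex.I • v)) / 4

/-- A `C²` function is strictly plurisubharmonic on an open set `D` if its Levi form is positive
definite at every point of `D`. -/
def StrictlyPlurisubharmonicOn (f : ℂ × ℂ → ℝ) (D : Set (ℂ × ℂ)) : Prop :=
  ContDiffOn ℝ 2 f D ∧ ∀ p ∈ D, ∀ v : ℂ × ℂ, v ≠ 0 → 0 < leviForm f p v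

/-- `ρ`, regarded as a function on the neighbourhood `V` of the closure of `Ω` (its values outside
`V` are irrelevant), is a smooth defining function of `Ω`. -/
structure IsDefiningFunction (Ω V : Set (ℂ × ℂ)) (ρ : ℂ × ℂ → ℝ) : Prop where
  isOpen : IsOpen V
  closure_subset : closure Ω ⊆ V
  smooth : ContDiffOn ℝ ∞ ρ V
  eq_neg : Ω = {p | p ∈ V ∧ ρ p < 0}
  fderiv_ne_zero : ∀ p ∈ frontier Ω, fderiv ℝ ρ p ≠ 0

/-- The exponents `η > 1` such that `ρ ^ η` is strictly plurisubharmonic on the part outside the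
closure of `Ω` of some neighbourhood `U` of the boundary of `Ω` (inside the domain `V` of `ρ`). -/
def steinExponents (Ω V : Set (ℂ × ℂ)) (ρ : ℂ × ℂ → ℝ) : Set ℝ :=
  {η | 1 < η ∧ ∃ U : Set (ℂ × ℂ), IsOpen U ∧ frontier Ω ⊆ U ∧ U ⊆ V ∧
    StrictlyPlurisubharmonicOn (fun p => ρ p ^ η) ((closure Ω)ᶜ ∩ U)}

/-- The Steinness exponent of the defining function `ρ : V → ℝ` of `Ω`, an extended real:
it is `⊤ = ∞` if there is no admissible exponent. -/
noncomputable def steinnessExponent (Ω V : Set (ℂ × ℂ)) (ρ : ℂ × ℂ → ℝ) : EReal :=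
  sInf ((fun η : ℝ => (η : EReal)) '' steinExponents Ω V ρ)

/-- The Steinness index of `Ω`: the infimum of the Steinness exponents of all its defining
functions. -/
noncomputable def steinnessIndex (Ω : Set (ℂ × ℂ)) : EReal :=
  sInf {s | ∃ (V : Set (ℂ × ℂ)) (ρ : ℂ × ℂ → ℝ),
    IsDefiningFunction Ω V ρ ∧ s = steinnessExponent Ω V ρ}

/-- The functions `φ` from which the worm domain with parameter `β` is built. -/
structure IsWormProfile (β : ℝ) (φ : ℝ → ℝ) : Prop where
  smooth : ContDiff ℝ ∞ φ
  nonneg : ∀ x, 0 ≤ φ x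
  even : ∀ x, φ (-x) = φ x
  convex : ConvexOn ℝ univ φ
  zero_set : φ ⁻¹' {0} = Icc (-(β - π / 2)) (β - π / 2)
  large : ∃ a : ℝ, 0 < a ∧ ∀ x, x < -a ∨ a < x → 1 < φ x
  deriv_ne_zero : ∀ x, φ x = 1 → deriv φ x ≠ 0

/-- The defining expression `|z - exp(i log |w|²)|² - (1 - φ(log |w|²))` of the worm domain. -/
noncomputable def wormFunction (φ : ℝ → ℝ) (p : ℂ × ℂ) : ℝ :=
  ‖p.1 - Complex.exp (Complex.I * (Real.log (‖p.2‖ ^ 2) : ℂ))‖ ^ 2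
    - (1 - φ (Real.log (‖p.2‖ ^ 2)))

/-- The worm domain; since `log |w|²` is only defined for `w ≠ 0`, so is the condition. -/
def wormDomain (φ : ℝ → ℝ) : Set (ℂ × ℂ) :=
  {p | p.2 ≠ 0 ∧ wormFunction φ p < 0}

/-! Put x = log|w|², κ = η / (η - 1), and let r be the worm function. The threshold for η is κ(2β -
π) = π: an exponent of any defining function satisfies κ(2β - π) ≤ π, and strict inequality suffices
for some defining function to have the exponent η. Since κ(2β - π) ≤ π says π ≤ 2(π - β)η, which no
η > 1 satisfies when β ≥ π, the index follows.

Necessity (`exponent_mul_width_le`). The boundary contains the annulus z = 0, |x| ≤ β - π/2, along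
which the centre of the disc turns through the angle 2β - π. If κ(2β - π) > π, there is k < κ such
that the holomorphic curves `wormCurve` stay outside the closure over a rectangle |Re ζ| ≤ π/(2k),
|Im ζ| ≤ Y. On them r = T² + 2T cos(kx) with T = t exp((k - 1) Im ζ). Thus ρ is O(t²) on the
vertical sides, while ρ^η grows there only like exp(η(k - 1)|Im ζ|). As η(k - 1) < k, some m in
between makes a small multiple of t^η cos(mx) cosh(m Im ζ) a harmonic majorant on the boundary of
the rectangle. The maximum principle carries this to ζ = 0, where ρ ≥ ct contradicts it.

Sufficiency (`exists_mem_steinExponents`). Take ρ = r τ(x)^(-1/κ), so that ρ^η = r^η τ^(1 - η), a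
composite of the jointly convex function R^η σ^(1 - η). Along curves adapted to the rotation of the
disc, positivity of the Levi form reduces to r(κ²τ + τ'') < κτ(φ + φ''). Over the annulus φ and φ''
vanish, and a positive τ with τ'' < -κ²τ is needed: cos(κ₁x) with κ₁ slightly above κ serves,
precisely because κ(2β - π) < π. Adding a multiple of φ keeps τ positive everywhere, and smallness
of r absorbs the resulting error. -/

/-! ### Second derivatives at a point. -/

/-- `j` is differentiable near `0` and its derivative has derivative `A` at `0`. -/
def HasDeriv2 (j : ℝ → ℝ) (A : ℝ) : Prop :=
  ∃ g : ℝ → ℝ, (∀ᶠ s in nhds 0, HasDerivAt j (g s) s) ∧ HasDerivAt g A 0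

namespace HasDeriv2

theorem unique {j : ℝ → ℝ} {A B : ℝ} (h : HasDeriv2 j A) (h' : HasDeriv2 j B) : A = B := by
  obtain ⟨g, hg, hA⟩ := h
  obtain ⟨g', hg', hB⟩ := h'
  have : g =ᶠ[nhds 0] g' := by
    filter_upwards [hg, hg'] with s h1 h2 using h1.unique h2
  exact (hA.congr_of_eventuallyEq this.symm).unique hB

theorem congr {j k : ℝ → ℝ} {A : ℝ} (h : HasDeriv2 j A) (hk : k =ᶠ[nhds 0] j) :
    HasDeriv2 k A := by
  obtain ⟨g, hg, hA⟩ := h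
  refine ⟨g, ?_, hA⟩
  filter_upwards [hg, hk.eventuallyEq_nhds] with s h1 h2 using h1.congr_of_eventuallyEq h2

theorem sub {j k : ℝ → ℝ} {A B : ℝ} (h : HasDeriv2 j A) (h' : HasDeriv2 k B) :
    HasDeriv2 (fun s => j s - k s) (A - B) := by
  obtain ⟨g, hg, hA⟩ := h
  obtain ⟨g', hg', hB⟩ := h'
  refine ⟨fun s => g s - g' s, ?_, hA.sub hB⟩
  filter_upwards [hg, hg'] with s h1 h2 using h1.sub h2

theorem add {j k : ℝ → ℝ} {A B : ℝ} (h : HasDeriv2 j A) (h' : HasDeriv2 k B) :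
    HasDeriv2 (fun s => j s + k s) (A + B) := by
  obtain ⟨g, hg, hA⟩ := h
  obtain ⟨g', hg', hB⟩ := h'
  refine ⟨fun s => g s + g' s, ?_, hA.add hB⟩
  filter_upwards [hg, hg'] with s h1 h2 using h1.add h2

theorem nonpos_of_isLocalMax {j : ℝ → ℝ} {A : ℝ} (h : HasDeriv2 j A) (hm : IsLocalMax j 0) :
    A ≤ 0 := by
  obtain ⟨g, hg, hA⟩ := h
  by_contra! hpos
  have hd : deriv j =ᶠ[nhds 0] g := by
    filter_upwards [hg] with s hs using hs.deriv
  have h0 : deriv j 0 = 0 := hm.deriv_eq_zero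
  have h2 : deriv (deriv j) 0 = A := (hA.congr_of_eventuallyEq hd).deriv
  have hc : ContinuousAt j 0 := hg.self_of_nhds.continuousAt
  -- A positive second derivative makes the maximum also a minimum, so `j` is locally constant and
  -- the second derivative vanishes.
  have hmin : IsLocalMin j 0 := isLocalMin_of_deriv_deriv_pos (by rw [h2]; exact hpos) h0 hc
  have hconst : j =ᶠ[nhds 0] fun _ => j 0 := by
    filter_upwards [hm, hmin] with s h1 h2 using le_antisymm h1 h2
  have : HasDeriv2 j 0 :=
    congr ⟨fun _ => 0, Filter.Eventually.of_forall fun s => hasDerivAt_const s _,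
      hasDerivAt_const _ _⟩ hconst
  exact hpos.ne' (unique ⟨g, hg, hA⟩ this)

/-- Convexity of `(R, σ) ↦ R ^ η * σ ^ (1 - η)`, in differential form. -/
theorem perspective {R S : ℝ → ℝ} {R₂ S₂ η : ℝ} (hη : 1 < η) (hR : HasDeriv2 R R₂)
    (hS : HasDeriv2 S S₂) (hR0 : 0 < R 0) (hS0 : 0 < S 0) :
    ∃ A, HasDeriv2 (fun s => R s ^ η * S s ^ (1 - η)) A ∧
      η * R 0 ^ (η - 1) * S 0 ^ (1 - η) * R₂ - (η - 1) * R 0 ^ η * S 0 ^ (-η) * S₂ ≤ A := by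
  obtain ⟨R', hR', hR₂⟩ := hR
  obtain ⟨S', hS', hS₂⟩ := hS
  have hR1 := hR'.self_of_nhds
  have hS1 := hS'.self_of_nhds
  have eR : ∀ᶠ s in nhds 0, 0 < R s := hR1.continuousAt.eventually (lt_mem_nhds hR0)
  have eS : ∀ᶠ s in nhds 0, 0 < S s := hS1.continuousAt.eventually (lt_mem_nhds hS0)
  have e1 : ∀ᶠ s in nhds 0, HasDerivAt (fun s => R s ^ η * S s ^ (1 - η))
      (η * (R s ^ (η - 1) * S s ^ (1 - η) * R' s) - (η - 1) * (R s ^ η * S s ^ (-η) * S' s)) s := by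
    filter_upwards [eR, eS, hR', hS'] with s h1 h2 h3 h4
    have a1 := h3.rpow_const (p := η) (Or.inl h1.ne')
    have a2 := h4.rpow_const (p := 1 - η) (Or.inl h2.ne')
    refine (a1.mul a2).congr_deriv ?_
    rw [show (1 - η - 1) = -η by ring]; ring
  have b1 := hR1.rpow_const (p := η) (Or.inl hR0.ne')
  have b2 := hR1.rpow_const (p := η - 1) (Or.inl hR0.ne')
  have b3 := hS1.rpow_const (p := 1 - η) (Or.inl hS0.ne')
  have b4 := hS1.rpow_const (p := -η) (Or.inl hS0.ne')
  refine ⟨_, ⟨_, e1, (((b2.mul b3).mul hR₂).const_mul η).sub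
    (((b1.mul b4).mul hS₂).const_mul (η - 1))⟩, ?_⟩
  have r1 : R 0 ^ (η - 1) = R 0 ^ (η - 2) * R 0 := by
    rw [← Real.rpow_add_one hR0.ne']; ring_nf
  have r2 : R 0 ^ η = R 0 ^ (η - 2) * R 0 * R 0 := by
    rw [← Real.rpow_add_one hR0.ne', ← Real.rpow_add_one hR0.ne']; ring_nf
  have s1 : S 0 ^ (-η) = S 0 ^ (-η - 1) * S 0 := by
    rw [← Real.rpow_add_one hS0.ne']; ring_nf
  have s2 : S 0 ^ (1 - η) = S 0 ^ (-η - 1) * S 0 * S 0 := by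
    rw [← Real.rpow_add_one hS0.ne', ← Real.rpow_add_one hS0.ne']; ring_nf
  simp only [Pi.mul_apply]
  rw [show η - 1 - 1 = η - 2 by ring, show 1 - η - 1 = -η by ring, r1, r2, s2, s1]
  -- This square is exactly the part of the second derivative that the stated bound discards.
  have hp : 0 ≤ η * (η - 1) * (R 0 ^ (η - 2) * S 0 ^ (-η - 1)) * (S 0 * R' 0 - R 0 * S' 0) ^ 2 := by
    have := Real.rpow_pos_of_pos hR0 (η - 2)
    have := Real.rpow_pos_of_pos hS0 (-η - 1)
    have : 0 < η - 1 := by linarith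
    positivity
  nlinarith [hp]

end HasDeriv2

/-! ### The Levi form along holomorphic curves. -/

theorem hasDeriv2_comp_curve {f : ℂ × ℂ → ℝ} {γ γ' : ℝ → ℂ × ℂ} {a : ℂ × ℂ}
    (hf : ContDiffAt ℝ 2 f (γ 0)) (hγ : ∀ s, HasDerivAt γ (γ' s) s) (hγ' : HasDerivAt γ' a 0) :
    HasDeriv2 (fun s => f (γ s))
      (fderiv ℝ (fderiv ℝ f) (γ 0) (γ' 0) (γ' 0) + fderiv ℝ f (γ 0) a) := by
  refine ⟨fun s => fderiv ℝ f (γ s) (γ' s), ?_, ?_⟩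
  · have h1 : ∀ᶠ q in nhds (γ 0), DifferentiableAt ℝ f q := by
      filter_upwards [hf.eventually (by simp)] with q hq using hq.differentiableAt (by simp)
    filter_upwards [(hγ 0).continuousAt.eventually h1] with s hs
    exact hs.hasFDerivAt.comp_hasDerivAt s (hγ s)
  · have h2 : DifferentiableAt ℝ (fderiv ℝ f) (γ 0) :=
      (hf.fderiv_right (m := 1) (by norm_num)).differentiableAt (by simp)
    exact (h2.hasFDerivAt.comp_hasDerivAt (0 : ℝ) (hγ 0)).clm_apply hγ'

/-- The Levi form is a quarter of the Laplacian along any holomorphic curve. -/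
theorem leviForm_eq_along_curve {f : ℂ × ℂ → ℝ} {G G' : ℂ → ℂ × ℂ} {G₂ : ℂ × ℂ} {ζ : ℂ}
    (hf : ContDiffAt ℝ 2 f (G ζ)) (hG : ∀ z, HasDerivAt G (G' z) z) (hG' : HasDerivAt G' G₂ ζ) :
    ∃ A B, HasDeriv2 (fun s : ℝ => f (G (ζ + s))) A ∧
      HasDeriv2 (fun s : ℝ => f (G (ζ + s * Complex.I))) B ∧
      A + B = 4 * leviForm f (G ζ) (G' ζ) := by
  have key : ∀ u : ℂ, HasDeriv2 (fun s : ℝ => f (G (ζ + s * u)))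
      (fderiv ℝ (fderiv ℝ f) (G ζ) (u • G' ζ) (u • G' ζ) + fderiv ℝ f (G ζ) (u • u • G₂)) := by
    intro u
    have hl : ∀ s : ℝ, HasDerivAt (fun s : ℝ => ζ + s * u) u s := fun s => by
      simpa using ((hasDerivAt_id s).ofReal_comp.mul_const u).const_add ζ
    have h1 : ∀ s : ℝ, HasDerivAt (fun s : ℝ => G (ζ + s * u)) (u • G' (ζ + s * u)) s :=
      fun s => (hG _).scomp s (hl s)
    have h2 : HasDerivAt (fun s : ℝ => u • G' (ζ + s * u)) (u • u • G₂) 0 := by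
      have : HasDerivAt G' G₂ (ζ + ((0 : ℝ) : ℂ) * u) := by simpa using hG'
      exact (this.scomp (0 : ℝ) (hl 0)).const_smul u
    have := hasDeriv2_comp_curve (f := f) (γ := fun s : ℝ => G (ζ + s * u)) (by simpa using hf) h1 h2
    simpa using this
  refine ⟨_, _, by simpa using key 1, key Complex.I, ?_⟩
  -- The accelerations in the directions 1 and i are opposite, so the first-order terms cancel.
  have : Complex.I • Complex.I • G₂ = -G₂ := by
    rw [smul_smul, Complex.I_mul_I, neg_one_smul]
  rw [this, leviForm, map_neg]; ring

/-! ### The worm function and the boundary of the worm domain. -/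

theorem log_norm_sq_mul_exp {w : ℂ} (hw : w ≠ 0) (c : ℂ) :
    Real.log (‖w * Complex.exp c‖ ^ 2) = Real.log (‖w‖ ^ 2) + 2 * c.re := by
  have h : ‖w‖ ≠ 0 := norm_ne_zero_iff.mpr hw
  rw [norm_mul, Complex.norm_exp, mul_pow, Real.log_mul (by positivity) (by positivity),
    Real.log_pow (x := rexp _), Real.log_exp]
  norm_num

theorem isOpen_snd_ne_zero : IsOpen {p : ℂ × ℂ | p.2 ≠ 0} :=
  isOpen_ne_fun continuous_snd continuous_const

theorem contDiffAt_log_norm_sq {p : ℂ × ℂ} (hp : p.2 ≠ 0) :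
    ContDiffAt ℝ ∞ (fun p : ℂ × ℂ => Real.log (‖p.2‖ ^ 2)) p :=
  ((contDiff_snd.norm_sq ℝ).contDiffAt).log (by simpa using hp)

theorem contDiffAt_wormFunction {φ : ℝ → ℝ} (hφ : ContDiff ℝ ∞ φ) {p : ℂ × ℂ} (hp : p.2 ≠ 0) :
    ContDiffAt ℝ ∞ (wormFunction φ) p := by
  have h1 := contDiffAt_log_norm_sq hp
  have h2 : ContDiffAt ℝ ∞ (fun p : ℂ × ℂ => ((Real.log (‖p.2‖ ^ 2) : ℝ) : ℂ)) p :=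
    Complex.ofRealCLM.contDiff.contDiffAt.comp p h1
  have h3 : ContDiffAt ℝ ∞ (fun p : ℂ × ℂ => φ (Real.log (‖p.2‖ ^ 2))) p :=
    hφ.contDiffAt.comp p h1
  exact ((contDiffAt_fst.sub (contDiffAt_const.mul h2).cexp).norm_sq ℝ).sub
    (contDiffAt_const.sub h3)

theorem continuousAt_wormFunction {φ : ℝ → ℝ} (hφ : ContDiff ℝ ∞ φ) {p : ℂ × ℂ}
    (hp : p.2 ≠ 0) : ContinuousAt (wormFunction φ) p :=
  (contDiffAt_wormFunction hφ hp).continuousAt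

theorem isOpen_wormDomain {φ : ℝ → ℝ} (hφ : ContDiff ℝ ∞ φ) : IsOpen (wormDomain φ) := by
  rw [isOpen_iff_mem_nhds]
  rintro p ⟨hp, hr⟩
  filter_upwards [isOpen_snd_ne_zero.mem_nhds hp,
    (continuousAt_wormFunction hφ hp).eventually (gt_mem_nhds hr)] with q h1 h2 using ⟨h1, h2⟩

/-- The derivative of the worm function does not vanish on its zero set. -/
theorem fderiv_wormFunction_ne_zero {φ : ℝ → ℝ} (hφ : ContDiff ℝ ∞ φ)
    (hd : ∀ x, φ x = 1 → deriv φ x ≠ 0) {p : ℂ × ℂ} (hp : p.2 ≠ 0) (hr : wormFunction φ p = 0) :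
    fderiv ℝ (wormFunction φ) p ≠ 0 := by
  intro h0
  have hdiff : HasFDerivAt (wormFunction φ) (0 : ℂ × ℂ →L[ℝ] ℝ) p := by
    rw [← h0]; exact ((contDiffAt_wormFunction hφ hp).differentiableAt (by simp)).hasFDerivAt
  obtain ⟨z, w⟩ := p
  simp only at hp
  set x := Real.log (‖w‖ ^ 2) with hx
  set e := Complex.exp (Complex.I * (x : ℂ)) with he
  -- At the centre of the disc φ = 1: moving |w| changes the squared distance only to second order,
  -- so the derivative is φ' ≠ 0. Elsewhere, moving z radially from the centre works.
  by_cases hz : z = e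
  · have hφx : φ x = 1 := by
      simp only [wormFunction, ← hx, ← he, hz, sub_self, norm_zero] at hr
      linarith
    have hc : HasDerivAt (fun s : ℝ => (z, w * Complex.exp ((s / 2 : ℝ) : ℂ)))
        ((0 : ℂ), w * (1 / 2 : ℝ)) 0 := by
      refine (hasDerivAt_const _ _).prodMk ?_
      have : HasDerivAt (fun s : ℝ => ((s / 2 : ℝ) : ℂ)) ((1 / 2 : ℝ) : ℂ) 0 :=
        ((hasDerivAt_id (0 : ℝ)).div_const 2).ofReal_comp
      simpa using this.cexp.const_mul w
    have h1 := HasFDerivAt.comp_hasDerivAt (0 : ℝ) (l := wormFunction φ) (l' := 0)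
      (by simpa using hdiff) hc
    have h2 : HasDerivAt (fun s : ℝ => ‖Complex.exp (Complex.I * (x : ℂ)) -
        Complex.exp (Complex.I * ((x + s : ℝ) : ℂ))‖ ^ 2 - (1 - φ (x + s))) (deriv φ x) 0 := by
      have a1 : HasDerivAt (fun s : ℝ => ((x + s : ℝ) : ℂ)) ((1 : ℝ) : ℂ) 0 :=
        ((hasDerivAt_id (0 : ℝ)).const_add x).ofReal_comp
      have a2 := ((a1.const_mul Complex.I).cexp.const_sub
        (Complex.exp (Complex.I * (x : ℂ)))).norm_sq
      have a3 : HasDerivAt φ (deriv φ x) (x + 0) := by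
        simpa using (hφ.differentiable (by simp) x).hasDerivAt
      have a4 := a3.comp (0 : ℝ) ((hasDerivAt_id (0 : ℝ)).const_add x)
      refine (a2.sub (a4.const_sub 1)).congr_deriv ?_
      simp
    have h3 : (wormFunction φ ∘ fun s : ℝ => (z, w * Complex.exp ((s / 2 : ℝ) : ℂ))) =
        (fun s : ℝ => ‖Complex.exp (Complex.I * (x : ℂ)) -
        Complex.exp (Complex.I * ((x + s : ℝ) : ℂ))‖ ^ 2 - (1 - φ (x + s))) := by
      funext s
      simp only [Function.comp, wormFunction, log_norm_sq_mul_exp hp, Complex.ofReal_re, hz, ← hx]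
      rw [show 2 * (s / 2) = s by ring, he]
    rw [h3] at h1
    exact hd x hφx (by simpa using h2.unique h1)
  · have hc : HasDerivAt (fun s : ℝ => (z + s * (z - e), w)) (z - e, (0 : ℂ)) 0 := by
      refine HasDerivAt.prodMk ?_ (hasDerivAt_const _ _)
      simpa using ((hasDerivAt_id (0 : ℝ)).ofReal_comp.mul_const (z - e)).const_add z
    have h1 := HasFDerivAt.comp_hasDerivAt (0 : ℝ) (l := wormFunction φ) (l' := 0)
      (by simpa using hdiff) hc
    have h2 : HasDerivAt (fun s : ℝ => (1 + s) ^ 2 * ‖z - e‖ ^ 2 - (1 - φ x))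
        (2 * ‖z - e‖ ^ 2) 0 := by
      have := ((((hasDerivAt_id (0 : ℝ)).const_add 1).pow 2).mul_const (‖z - e‖ ^ 2)).sub_const
        (1 - φ x)
      simpa using this
    have h3 : (wormFunction φ ∘ fun s : ℝ => (z + s * (z - e), w)) =
        (fun s : ℝ => (1 + s) ^ 2 * ‖z - e‖ ^ 2 - (1 - φ x)) := by
      funext s
      simp only [Function.comp, wormFunction, ← hx, ← he]
      rw [show z + s * (z - e) - e = ((1 + s : ℝ) : ℂ) * (z - e) by push_cast; ring, norm_mul,
        mul_pow, Complex.norm_real, Real.norm_eq_abs, sq_abs]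
    rw [h3] at h1
    have := h2.unique h1
    have hne : ‖z - e‖ ≠ 0 := norm_ne_zero_iff.mpr (sub_ne_zero.mpr hz)
    simp [hne] at this

namespace IsWormProfile

variable {β : ℝ} {φ : ℝ → ℝ}

/-- The field `large` keeps |w|² ≥ exp(-a) on the domain, so its closure cannot reach w = 0, where
the worm function is not continuous. -/
theorem closure_subset (h : IsWormProfile β φ) :
    closure (wormDomain φ) ⊆ {p | p.2 ≠ 0 ∧ wormFunction φ p ≤ 0} := by
  obtain ⟨a, ha, hlarge⟩ := h.large
  have h1 : closure (wormDomain φ) ⊆ {p | rexp (-a) ≤ ‖p.2‖ ^ 2} := by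
    refine closure_minimal ?_ (isClosed_le continuous_const (continuous_snd.norm.pow 2))
    rintro p ⟨hp, hr⟩
    have hpos : 0 < ‖p.2‖ ^ 2 := by have := norm_pos_iff.mpr hp; positivity
    by_contra hlt
    have hlt' : ‖p.2‖ ^ 2 < rexp (-a) := by simpa using hlt
    have := hlarge _ (Or.inl ((Real.log_lt_iff_lt_exp hpos).mpr hlt'))
    unfold wormFunction at hr
    nlinarith [sq_nonneg ‖p.1 - Complex.exp (Complex.I * (Real.log (‖p.2‖ ^ 2) : ℂ))‖]
  intro p hp
  have hp2 : p.2 ≠ 0 := by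
    intro h0
    have := h1 hp
    simp only [h0, mem_ofPred_eq, norm_zero] at this
    have := Real.exp_pos (-a)
    norm_num at *
    linarith
  refine ⟨hp2, ?_⟩
  by_contra! hpos
  obtain ⟨q, hq, hq'⟩ := mem_closure_iff_nhds.mp hp _
    ((continuousAt_wormFunction h.smooth hp2).eventually (lt_mem_nhds hpos))
  exact absurd hq'.2 (not_lt.mpr (le_of_lt hq))

/-- Otherwise the point would be a local minimum of the worm function, whose derivative does not
vanish there. -/
theorem mem_closure_of_eq_zero (h : IsWormProfile β φ) {p : ℂ × ℂ} (hp : p.2 ≠ 0)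
    (hr : wormFunction φ p = 0) : p ∈ closure (wormDomain φ) := by
  by_contra hcl
  have hmin : IsLocalMin (wormFunction φ) p := by
    filter_upwards [isClosed_closure.isOpen_compl.mem_nhds hcl,
      isOpen_snd_ne_zero.mem_nhds hp] with q h1 h2
    rw [hr]
    by_contra! hlt
    exact h1 (subset_closure ⟨h2, hlt⟩)
  exact fderiv_wormFunction_ne_zero h.smooth h.deriv_ne_zero hp hr hmin.fderiv_eq_zero

theorem mem_frontier_iff (h : IsWormProfile β φ) {p : ℂ × ℂ} :
    p ∈ frontier (wormDomain φ) ↔ p.2 ≠ 0 ∧ wormFunction φ p = 0 := by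
  rw [(isOpen_wormDomain h.smooth).frontier_eq, mem_sdiff]
  constructor
  · rintro ⟨h1, h2⟩
    obtain ⟨h3, h4⟩ := h.closure_subset h1
    refine ⟨h3, h4.antisymm ?_⟩
    by_contra! hlt
    exact h2 ⟨h3, hlt⟩
  · rintro ⟨h1, h2⟩
    exact ⟨h.mem_closure_of_eq_zero h1 h2, fun h3 => absurd h2 h3.2.ne⟩

theorem notMem_closure (h : IsWormProfile β φ) {p : ℂ × ℂ}
    (hr : 0 < wormFunction φ p) : p ∉ closure (wormDomain φ) :=
  fun hp => absurd (h.closure_subset hp).2 (not_le.mpr hr)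

theorem wormFunction_pos (h : IsWormProfile β φ) {p : ℂ × ℂ} (hp : p.2 ≠ 0)
    (hc : p ∉ closure (wormDomain φ)) : 0 < wormFunction φ p := by
  by_contra! hle
  rcases hle.lt_or_eq with h1 | h1
  · exact hc (subset_closure ⟨hp, h1⟩)
  · exact hc (h.mem_closure_of_eq_zero hp h1)

end IsWormProfile

/-! ### Maximum principle on a rectangle. -/

theorem hasDeriv2_cos_add (m x : ℝ) :
    HasDeriv2 (fun s => Real.cos (m * (x + s))) (-(m ^ 2 * Real.cos (m * x))) := by
  have hl : ∀ s : ℝ, HasDerivAt (fun s : ℝ => m * (x + s)) m s := fun s => by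
    simpa using ((hasDerivAt_id s).const_add x).const_mul m
  refine ⟨fun s => -Real.sin (m * (x + s)) * m, .of_forall fun s => (hl s).cos, ?_⟩
  refine ((hl 0).sin.neg.mul_const m).congr_deriv ?_
  simp only [add_zero]; ring

theorem hasDeriv2_cosh_add (m x : ℝ) :
    HasDeriv2 (fun s => Real.cosh (m * (x + s))) (m ^ 2 * Real.cosh (m * x)) := by
  have hl : ∀ s : ℝ, HasDerivAt (fun s : ℝ => m * (x + s)) m s := fun s => by
    simpa using ((hasDerivAt_id s).const_add x).const_mul m
  refine ⟨fun s => Real.sinh (m * (x + s)) * m, .of_forall fun s => (hl s).cosh, ?_⟩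
  refine ((hl 0).sinh.mul_const m).congr_deriv ?_
  simp only [add_zero]; ring

theorem HasDeriv2.const_mul {j : ℝ → ℝ} {A : ℝ} (c : ℝ) (h : HasDeriv2 j A) :
    HasDeriv2 (fun s => c * j s) (c * A) := by
  obtain ⟨g, hg, hA⟩ := h
  refine ⟨fun s => c * g s, ?_, hA.const_mul c⟩
  filter_upwards [hg] with s h1 using h1.const_mul c

/-- Comparison of a strictly plurisubharmonic function along a holomorphic curve over a rectangle
with the harmonic function `cos (m x) * cosh (m y)`. -/
theorem le_cos_mul_cosh_of_boundary {u : ℂ × ℂ → ℝ} {D : Set (ℂ × ℂ)} (hD : IsOpen D)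
    (hu : StrictlyPlurisubharmonicOn u D) {G G' : ℂ → ℂ × ℂ} (hG : ∀ z, HasDerivAt G (G' z) z)
    (hG' : Differentiable ℂ G') (hne : ∀ z, G' z ≠ 0) {a Y E m : ℝ}
    (hmaps : ∀ ζ : ℂ, |ζ.re| ≤ a → |ζ.im| ≤ Y → G ζ ∈ D)
    (hbd : ∀ ζ : ℂ, |ζ.re| ≤ a → |ζ.im| ≤ Y → (|ζ.re| = a ∨ |ζ.im| = Y) →
      u (G ζ) ≤ E * (Real.cos (m * ζ.re) * Real.cosh (m * ζ.im)))
    {ζ : ℂ} (h1 : |ζ.re| ≤ a) (h2 : |ζ.im| ≤ Y) :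
    u (G ζ) ≤ E * (Real.cos (m * ζ.re) * Real.cosh (m * ζ.im)) := by
  by_contra! hlt
  let F : ℂ → ℝ := fun ζ => u (G ζ) - E * (Real.cos (m * ζ.re) * Real.cosh (m * ζ.im))
  let Q : Set ℂ := {ζ | |ζ.re| ≤ a ∧ |ζ.im| ≤ Y}
  have hQ : IsCompact Q := by
    have : Q = Icc (-a) a ×ℂ Icc (-Y) Y := by
      ext z; simp [Q, Complex.mem_reProdIm, abs_le]
    rw [this]; exact isCompact_Icc.reProdIm isCompact_Icc
  have hcG : Continuous G := continuous_iff_continuousAt.mpr fun z => (hG z).continuousAt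
  have hF : ContinuousOn F Q := by
    refine ContinuousOn.sub (hu.1.continuousOn.comp hcG.continuousOn fun z hz => hmaps z hz.1 hz.2)
      (Continuous.continuousOn ?_)
    fun_prop
  obtain ⟨ξ, hξ, hmax⟩ := hQ.exists_isMaxOn ⟨ζ, h1, h2⟩ hF
  have hpos : 0 < F ξ := lt_of_lt_of_le (sub_pos.mpr hlt) (hmax ⟨h1, h2⟩)
  have hint : |ξ.re| < a ∧ |ξ.im| < Y := by
    have hb : ¬ (|ξ.re| = a ∨ |ξ.im| = Y) := fun h =>
      absurd (hbd ξ hξ.1 hξ.2 h) (not_le.mpr (sub_pos.mp hpos))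
    push Not at hb
    exact ⟨lt_of_le_of_ne hξ.1 hb.1, lt_of_le_of_ne hξ.2 hb.2⟩
  have hloc : IsLocalMax F ξ := by
    have e1 : IsOpen {z : ℂ | |z.re| < a} := isOpen_lt (by fun_prop) continuous_const
    have e2 : IsOpen {z : ℂ | |z.im| < Y} := isOpen_lt (by fun_prop) continuous_const
    filter_upwards [(e1.inter e2).mem_nhds hint] with z hz using hmax ⟨hz.1.le, hz.2.le⟩
  have hD' : G ξ ∈ D := hmaps ξ hξ.1 hξ.2
  obtain ⟨A, B, hA, hB, hAB⟩ := leviForm_eq_along_curve (hu.1.contDiffAt (hD.mem_nhds hD')) hG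
    (hG' ξ).hasDerivAt
  have hlevi := hu.2 _ hD' _ (hne ξ)
  have hA' : HasDeriv2 (fun s : ℝ => F (ξ + s)) (A - E * Real.cosh (m * ξ.im) *
      -(m ^ 2 * Real.cos (m * ξ.re))) := by
    refine (hA.sub ((hasDeriv2_cos_add m ξ.re).const_mul (E * Real.cosh (m * ξ.im)))).congr
      (.of_forall fun s => ?_)
    simp [F]; ring
  have hB' : HasDeriv2 (fun s : ℝ => F (ξ + s * Complex.I)) (B - E * Real.cos (m * ξ.re) *
      (m ^ 2 * Real.cosh (m * ξ.im))) := by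
    refine (hB.sub ((hasDeriv2_cosh_add m ξ.im).const_mul (E * Real.cos (m * ξ.re)))).congr
      (.of_forall fun s => ?_)
    simp [F]; ring
  have ht : ∀ c : ℂ, IsLocalMax (fun s : ℝ => F (ξ + s * c)) 0 := fun c => by
    have hc : Filter.Tendsto (fun s : ℝ => ξ + s * c) (nhds 0) (nhds ξ) := by
      have : Continuous fun s : ℝ => ξ + s * c := by fun_prop
      simpa using this.tendsto 0
    filter_upwards [hc.eventually hloc] with s hs
    simpa using hs
  have hA0 := hA'.nonpos_of_isLocalMax (by simpa using ht 1)
  have hB0 := hB'.nonpos_of_isLocalMax (ht Complex.I)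
  -- The second derivatives of the harmonic function cancel in the sum, leaving four times the Levi
  -- form, which is positive, bounded by zero.
  nlinarith

/-! ### Arbitrary defining functions near the flat annulus. -/

/-- A `C¹` function is uniformly Lipschitz in the first variable near `{0} × K`, `K` compact. -/
theorem exists_lipschitz_fst {ρ : ℂ × ℂ → ℝ} {U : Set (ℂ × ℂ)} (hU : IsOpen U)
    (hρ : ContDiffOn ℝ ∞ ρ U) {K : Set ℂ} (hK : IsCompact K) (hKU : ∀ w ∈ K, ((0 : ℂ), w) ∈ U) :
    ∃ δ > 0, ∃ C > 0, ∀ w ∈ K, ∀ z : ℂ, ‖z‖ ≤ δ → (z, w) ∈ U ∧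
      ∀ z' : ℂ, ‖z'‖ ≤ δ → |ρ (z, w) - ρ (z', w)| ≤ C * ‖z - z'‖ := by
  obtain ⟨A, B, hA, -, h0, hKB, hAB⟩ := generalized_tube_lemma (isCompact_singleton (x := (0 : ℂ)))
    hK hU (by rintro ⟨z, w⟩ ⟨hz, hw⟩; obtain rfl : z = 0 := hz; exact hKU w hw)
  obtain ⟨δ, hδ, hball⟩ := Metric.nhds_basis_closedBall.mem_iff.mp
    (hA.mem_nhds (h0 (mem_singleton 0)))
  have hsub : Metric.closedBall (0 : ℂ) δ ×ˢ K ⊆ U := (prod_mono hball hKB).trans hAB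
  obtain ⟨C, hC⟩ := ((isCompact_closedBall (0 : ℂ) δ).prod hK).exists_bound_of_continuousOn
    ((hρ.continuousOn_fderiv_of_isOpen hU (by simp)).mono hsub)
  refine ⟨δ, hδ, max C 1, by positivity, fun w hw z hz => ?_⟩
  refine ⟨hsub ⟨by simpa using hz, hw⟩, fun z' hz' => ?_⟩
  have hd : ∀ y ∈ Metric.closedBall (0 : ℂ) δ, HasFDerivWithinAt (fun y => ρ (y, w))
      ((fderiv ℝ ρ (y, w)).comp (ContinuousLinearMap.inl ℝ ℂ ℂ)) (Metric.closedBall (0 : ℂ) δ) y := by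
    intro y hy
    have h1 : HasFDerivAt ρ (fderiv ℝ ρ (y, w)) (y, w) :=
      ((hρ.contDiffAt (hU.mem_nhds (hsub ⟨hy, hw⟩))).differentiableAt (by simp)).hasFDerivAt
    exact (h1.comp y (hasFDerivAt_prodMk_left y w)).hasFDerivWithinAt
  have hb : ∀ y ∈ Metric.closedBall (0 : ℂ) δ,
      ‖(fderiv ℝ ρ (y, w)).comp (ContinuousLinearMap.inl ℝ ℂ ℂ)‖ ≤ max C 1 := by
    intro y hy
    calc _ ≤ ‖fderiv ℝ ρ (y, w)‖ * ‖ContinuousLinearMap.inl ℝ ℂ ℂ‖ :=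
          ContinuousLinearMap.opNorm_comp_le _ _
      _ ≤ ‖fderiv ℝ ρ (y, w)‖ * 1 := by
          gcongr; exact ContinuousLinearMap.norm_inl_le_one ℝ ℂ ℂ
      _ ≤ max C 1 := by rw [mul_one]; exact (hC _ ⟨hy, hw⟩).trans (le_max_left _ _)
  simpa [Real.norm_eq_abs] using Convex.norm_image_sub_le_of_norm_hasFDerivWithin_le hd hb
    (convex_closedBall 0 δ) (x := z') (y := z) (by simpa using hz') (by simpa using hz)

namespace IsDefiningFunction

variable {Ω V : Set (ℂ × ℂ)} {ρ : ℂ × ℂ → ℝ}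

theorem nonneg (h : IsDefiningFunction Ω V ρ) {p : ℂ × ℂ} (hV : p ∈ V) (hp : p ∉ Ω) :
    0 ≤ ρ p := by
  by_contra! hlt
  exact hp (h.eq_neg ▸ ⟨hV, hlt⟩)

theorem isOpen_domain (h : IsDefiningFunction Ω V ρ) : IsOpen Ω := by
  rw [h.eq_neg]
  exact h.smooth.continuousOn.isOpen_inter_preimage h.isOpen isOpen_Iio

theorem eq_zero_of_mem_frontier (h : IsDefiningFunction Ω V ρ) {p : ℂ × ℂ}
    (hp : p ∈ frontier Ω) : ρ p = 0 := by
  have hV := h.closure_subset hp.1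
  have hΩ : p ∉ Ω := by
    rw [h.isOpen_domain.frontier_eq] at hp; exact hp.2
  refine le_antisymm ?_ (h.nonneg hV hΩ)
  by_contra! hlt
  obtain ⟨q, hq, hq'⟩ := mem_closure_iff_nhds.mp hp.1 _
    ((h.smooth.continuousOn.continuousAt (h.isOpen.mem_nhds hV)).eventually (lt_mem_nhds hlt))
  rw [h.eq_neg] at hq'
  exact absurd hq'.2 (not_lt.mpr (le_of_lt hq))

end IsDefiningFunction

namespace IsWormProfile

variable {β : ℝ} {φ : ℝ → ℝ}

theorem eq_zero_of_abs_le (h : IsWormProfile β φ) {x : ℝ} (hx : |x| ≤ β - π / 2) : φ x = 0 := by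
  have : x ∈ φ ⁻¹' {0} := by rw [h.zero_set]; exact abs_le.mp hx
  exact this

theorem mem_frontier_of_norm_eq_one (h : IsWormProfile β φ) {z w : ℂ} (hw : w ≠ 0)
    (hx : |Real.log (‖w‖ ^ 2)| ≤ β - π / 2)
    (hz : ‖z - Complex.exp (Complex.I * (Real.log (‖w‖ ^ 2) : ℂ))‖ = 1) :
    (z, w) ∈ frontier (wormDomain φ) := by
  refine h.mem_frontier_iff.mpr ⟨hw, ?_⟩
  simp only [wormFunction, hz, h.eq_zero_of_abs_le hx]
  norm_num

/-- The boundary contains the circle |z - 1| = 1 over w = 1 and the annulus z = 0 near w = 1. Hence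
dρ at (0, 1) kills (i, 0) and every (0, v), and must be nonzero on (1, 0). Its sign is fixed because
(s, 1) lies in the domain for small s > 0. -/
theorem exists_linear_lower_bound (h : IsWormProfile β φ) (hβ : π / 2 < β) {V : Set (ℂ × ℂ)}
    {ρ : ℂ × ℂ → ℝ} (hdef : IsDefiningFunction (wormDomain φ) V ρ) :
    ∃ c > 0, ∃ t₀ > 0, ∀ t : ℝ, 0 < t → t < t₀ → c * t ≤ ρ (-t, 1) := by
  have h01 : ((0 : ℂ), (1 : ℂ)) ∈ frontier (wormDomain φ) :=
    h.mem_frontier_of_norm_eq_one one_ne_zero (by simp; linarith) (by simp)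
  have hV := hdef.closure_subset h01.1
  have hd : HasFDerivAt ρ (fderiv ℝ ρ (0, 1)) (0, 1) :=
    ((hdef.smooth.contDiffAt (hdef.isOpen.mem_nhds hV)).differentiableAt (by simp)).hasFDerivAt
  set D := fderiv ℝ ρ (0, 1) with hD
  have hDI : D (Complex.I, 0) = 0 := by
    have hc : HasDerivAt (fun s : ℝ => (1 - Complex.exp (-(s * Complex.I)), (1 : ℂ)))
        (Complex.I, (0 : ℂ)) 0 := by
      refine HasDerivAt.prodMk ?_ (hasDerivAt_const _ _)
      have := ((hasDerivAt_id (0 : ℝ)).ofReal_comp.mul_const Complex.I).neg.cexp.const_sub 1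
      simpa using this
    have h1 := HasFDerivAt.comp_hasDerivAt (0 : ℝ) (l := ρ) (l' := D) (by simpa using hd) hc
    have h2 : (ρ ∘ fun s : ℝ => (1 - Complex.exp (-(s * Complex.I)), (1 : ℂ))) = fun _ => 0 := by
      funext s
      refine hdef.eq_zero_of_mem_frontier (h.mem_frontier_of_norm_eq_one one_ne_zero
        (by simp; linarith) ?_)
      have : (-(s * Complex.I) : ℂ) = ((-s : ℝ) : ℂ) * Complex.I := by push_cast; ring
      simp [this, Complex.norm_exp_ofReal_mul_I, -Complex.ofReal_neg]
    rw [h2] at h1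
    exact h1.unique (hasDerivAt_const _ _)
  have hDw : ∀ v : ℂ, D (0, v) = 0 := by
    intro v
    have hc : HasDerivAt (fun s : ℝ => ((0 : ℂ), 1 + s * v)) ((0 : ℂ), v) 0 := by
      refine (hasDerivAt_const _ _).prodMk ?_
      simpa using ((hasDerivAt_id (0 : ℝ)).ofReal_comp.mul_const v).const_add 1
    have h1 := HasFDerivAt.comp_hasDerivAt (0 : ℝ) (l := ρ) (l' := D) (by simpa using hd) hc
    have hc0 : ContinuousAt (fun s : ℝ => 1 + s * v) 0 := by fun_prop
    have hc1 : ContinuousAt (fun s : ℝ => |Real.log (‖1 + s * v‖ ^ 2)|) 0 :=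
      ((hc0.norm.pow 2).log (show ‖1 + ((0 : ℝ) : ℂ) * v‖ ^ 2 ≠ 0 by simp)).abs
    have h2 : (ρ ∘ fun s : ℝ => ((0 : ℂ), 1 + s * v)) =ᶠ[nhds 0] fun _ => 0 := by
      filter_upwards [hc0.eventually_ne (show 1 + ((0 : ℝ) : ℂ) * v ≠ 0 by simp),
        hc1.eventually (gt_mem_nhds
          (show |Real.log (‖1 + ((0 : ℝ) : ℂ) * v‖ ^ 2)| < β - π / 2 by simp; linarith))] with s hs1 hs2
      refine hdef.eq_zero_of_mem_frontier (h.mem_frontier_of_norm_eq_one hs1 hs2.le ?_)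
      rw [zero_sub, norm_neg, mul_comm, Complex.norm_exp_ofReal_mul_I]
    exact (h1.congr_of_eventuallyEq h2.symm).unique (hasDerivAt_const _ _)
  have hD1 : D (1, 0) ≠ 0 := by
    intro h0
    refine hdef.fderiv_ne_zero _ h01 (ContinuousLinearMap.ext fun v => ?_)
    have : v = v.1.re • ((1 : ℂ), (0 : ℂ)) + v.1.im • (Complex.I, (0 : ℂ)) + ((0 : ℂ), v.2) := by
      ext <;> simp
    rw [← hD, this, map_add, map_add, map_smul, map_smul, h0, hDI, hDw]
    simp
  have hg : HasDerivAt (fun s : ℝ => ρ (-s, 1)) (-D (1, 0)) 0 := by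
    have hc : HasDerivAt (fun s : ℝ => (-(s : ℂ), (1 : ℂ))) (-(1 : ℂ), (0 : ℂ)) 0 :=
      HasDerivAt.prodMk (by
          have := (hasDerivAt_id (0 : ℝ)).ofReal_comp.fun_neg
          simpa using this)
        (hasDerivAt_const _ _)
    have h1 := HasFDerivAt.comp_hasDerivAt (0 : ℝ) (l := ρ) (l' := D) (by simpa using hd) hc
    refine h1.congr_deriv ?_
    rw [← map_neg]; simp
  have hd0 := neg_ne_zero.mpr hD1
  generalize -D (1, 0) = d at hg hd0
  have hg0 : ρ (0, 1) = 0 := hdef.eq_zero_of_mem_frontier h01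
  have hev : ∀ᶠ s : ℝ in nhds 0, |ρ (-s, 1) - s * d| ≤ |d| / 2 * |s| := by
    have := (hasDerivAt_iff_isLittleO.mp hg).def (c := |d| / 2) (by positivity)
    simpa [hg0] using this
  obtain ⟨r, hr, hball⟩ := Metric.eventually_nhds_iff.mp hev
  have hdpos : 0 < d := by
    by_contra! hneg
    have hlt : d < 0 := lt_of_le_of_ne hneg hd0
    set s := min (r / 2) 1 with hs
    have hs0 : 0 < s := by positivity
    have hs1 : s < r := (min_le_left _ _).trans_lt (by linarith)
    have hs2 : s ≤ 1 := min_le_right _ _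
    have h1 := hball (y := -s) (by simpa [abs_of_pos hs0] using hs1)
    have hmem : ((s : ℂ), (1 : ℂ)) ∈ wormDomain φ := by
      refine ⟨one_ne_zero, ?_⟩
      have : ‖(s : ℂ) - 1‖ = 1 - s := by
        rw [← Complex.ofReal_one, ← Complex.ofReal_sub, Complex.norm_real, Real.norm_eq_abs,
          abs_of_nonpos (by linarith)]; ring
      simp [wormFunction, this, h.eq_zero_of_abs_le (x := 0) (by simp; linarith)]
      rw [abs_lt]; constructor <;> linarith
    rw [hdef.eq_neg] at hmem
    have h2 := hmem.2
    rw [abs_neg, abs_of_pos hs0, abs_of_neg hlt, abs_le] at h1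
    simp only [Complex.ofReal_neg, neg_neg] at h1
    nlinarith [mul_pos hs0 (neg_pos.mpr hlt)]
  refine ⟨d / 2, by positivity, r, hr, fun t ht htr => ?_⟩
  have h1 := hball (y := t) (by simpa [abs_of_pos ht] using htr)
  rw [abs_of_pos ht, abs_of_pos hdpos, abs_le] at h1
  linarith

end IsWormProfile

/-! ### Necessity: test curves along the annulus. -/

/-- The curve `ζ ↦ (-t exp (-i (k - 1) ζ), exp (ζ / 2))`, close to the flat part of the boundary
of the worm domain for small `t`. -/
noncomputable def wormCurve (t k : ℝ) (ζ : ℂ) : ℂ × ℂ :=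
  (-t * Complex.exp (-(Complex.I * (k - 1) * ζ)), Complex.exp (ζ / 2))

/-- The derivative of `wormCurve`. -/
noncomputable def wormCurveDeriv (t k : ℝ) (ζ : ℂ) : ℂ × ℂ :=
  (-t * (Complex.exp (-(Complex.I * (k - 1) * ζ)) * -(Complex.I * (k - 1))),
    Complex.exp (ζ / 2) * (1 / 2))

namespace wormCurve

variable (t k : ℝ) (ζ : ℂ)

theorem hasDerivAt : HasDerivAt (wormCurve t k) (wormCurveDeriv t k ζ) ζ := by
  refine HasDerivAt.prodMk ?_ ((hasDerivAt_id ζ).div_const 2).cexp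
  have : HasDerivAt (fun ζ : ℂ => -(Complex.I * (k - 1) * ζ)) (-(Complex.I * (k - 1))) ζ := by
    simpa using ((hasDerivAt_id ζ).const_mul (Complex.I * (k - 1))).fun_neg
  exact this.cexp.const_mul _

theorem differentiable_deriv : Differentiable ℂ (wormCurveDeriv t k) := by
  unfold wormCurveDeriv
  fun_prop

theorem deriv_ne_zero : wormCurveDeriv t k ζ ≠ 0 := by
  intro h
  have := congrArg Prod.snd h
  simp [wormCurveDeriv] at this

theorem snd_ne_zero : (wormCurve t k ζ).2 ≠ 0 := Complex.exp_ne_zero _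

theorem log_norm_sq_snd : Real.log (‖(wormCurve t k ζ).2‖ ^ 2) = ζ.re := by
  have := log_norm_sq_mul_exp one_ne_zero (ζ / 2)
  simp only [one_mul, norm_one, one_pow, Real.log_one, zero_add] at this
  rw [wormCurve, this]
  simp; ring

theorem norm_fst (ht : 0 < t) : ‖(wormCurve t k ζ).1‖ = t * rexp ((k - 1) * ζ.im) := by
  simp [wormCurve, Complex.norm_exp, abs_of_pos ht]

theorem fst_eq : (wormCurve t k ζ).1 = Complex.exp (Complex.I * ζ.re) *
    -((t * rexp ((k - 1) * ζ.im) : ℝ) * Complex.exp (-(k * ζ.re : ℝ) * Complex.I)) := by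
  rw [wormCurve]
  push_cast
  rw [mul_neg, neg_mul, neg_inj, mul_left_comm, mul_assoc, mul_assoc (t : ℂ)]
  congr 1
  rw [← mul_left_comm, ← Complex.exp_add, ← Complex.exp_add]
  congr 1
  conv_lhs => rw [← Complex.re_add_im ζ]
  linear_combination (-(k - 1) * (ζ.im : ℂ)) * Complex.I_mul_I

/-- In the frame rotated by exp(ix) the centre is 1 and z becomes -T exp(-ikx). The value is
therefore positive for |kx| ≤ π/2 and quadratic in T at the two ends. -/
theorem wormFunction_eq {φ : ℝ → ℝ} (hφ : φ ζ.re = 0) :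
    wormFunction φ (wormCurve t k ζ) =
      (t * rexp ((k - 1) * ζ.im)) ^ 2 + 2 * (t * rexp ((k - 1) * ζ.im)) * Real.cos (k * ζ.re) := by
  rw [wormFunction, log_norm_sq_snd, hφ, fst_eq]
  generalize t * rexp ((k - 1) * ζ.im) = T
  generalize k * ζ.re = y
  rw [show Complex.exp (Complex.I * ζ.re) * -((T : ℂ) * Complex.exp (-(y : ℝ) * Complex.I)) -
    Complex.exp (Complex.I * ζ.re) = -(Complex.exp (ζ.re * Complex.I) *
      (1 + (T : ℂ) * Complex.exp ((-y : ℝ) * Complex.I))) by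
        push_cast; rw [mul_comm Complex.I (ζ.re : ℂ)]; ring, norm_neg, norm_mul,
    Complex.norm_exp_ofReal_mul_I, one_mul, ← Complex.normSq_eq_norm_sq, Complex.normSq_apply,
    Complex.exp_mul_I, ← Complex.ofReal_cos, ← Complex.ofReal_sin]
  simp [-Complex.ofReal_cos, -Complex.ofReal_sin]
  nlinarith [Real.sin_sq_add_cos_sq y]

end wormCurve

/-- Points of the unit circle centred at `1` approximate the imaginary axis to second order. -/
theorem exists_unit_circle_near {T s : ℝ} (hT0 : 0 ≤ T) (hT : T ≤ 1) (hs : |s| = 1) :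
    ∃ q : ℂ, ‖q - 1‖ = 1 ∧ ‖q‖ ≤ 2 * T ∧ ‖s * T * Complex.I - q‖ ≤ T ^ 2 := by
  have hn : ‖(s * T * Complex.I : ℂ)‖ = T := by
    simp [hs, abs_of_nonneg hT0]
  have h1 : ‖1 - Complex.exp (-(s * T * Complex.I)) - s * T * Complex.I‖ ≤ T ^ 2 := by
    have := Complex.norm_exp_sub_one_sub_id_le (x := -(s * T * Complex.I)) (by rw [norm_neg, hn]; exact hT)
    rw [norm_neg, hn] at this
    rwa [show 1 - Complex.exp (-(s * T * Complex.I)) - s * T * Complex.I =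
      -(Complex.exp (-(s * T * Complex.I)) - 1 - -(s * T * Complex.I)) by ring, norm_neg]
  refine ⟨1 - Complex.exp (-(s * T * Complex.I)), ?_, ?_, by rw [norm_sub_rev]; exact h1⟩
  · rw [show 1 - Complex.exp (-(s * T * Complex.I)) - 1 =
      -Complex.exp ((-(s * T) : ℝ) * Complex.I) by push_cast; ring_nf, norm_neg,
      Complex.norm_exp_ofReal_mul_I]
  · calc _ = ‖(1 - Complex.exp (-(s * T * Complex.I)) - s * T * Complex.I) + s * T * Complex.I‖ := by
          ring_nf
      _ ≤ T ^ 2 + T := (norm_add_le _ _).trans (by rw [hn]; linarith)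
      _ ≤ 2 * T := by nlinarith

theorem isCompact_annulus (a b : ℝ) : IsCompact {w : ℂ | a ≤ ‖w‖ ^ 2 ∧ ‖w‖ ^ 2 ≤ b} := by
  refine Metric.isCompact_of_isClosed_isBounded ?_ ?_
  · have h1 : IsClosed {w : ℂ | a ≤ ‖w‖ ^ 2} := isClosed_le continuous_const (by fun_prop)
    have h2 : IsClosed {w : ℂ | ‖w‖ ^ 2 ≤ b} := isClosed_le (by fun_prop) continuous_const
    exact h1.inter h2
  · refine (Metric.isBounded_closedBall (x := (0 : ℂ)) (r := 1 + |b|)).subset fun w hw => ?_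
    have := hw.2
    rw [mem_closedBall_zero_iff]
    nlinarith [norm_nonneg w, le_abs_self b, abs_nonneg b]

namespace IsWormProfile

variable {β : ℝ} {φ : ℝ → ℝ}

/-- The bound that plurisubharmonicity near the flat annulus puts on an exponent. -/
theorem exponent_mul_width_le (h : IsWormProfile β φ) (hβ : π / 2 < β) {V : Set (ℂ × ℂ)}
    {ρ : ℂ × ℂ → ℝ} (hdef : IsDefiningFunction (wormDomain φ) V ρ) {η : ℝ}
    (hη : η ∈ steinExponents (wormDomain φ) V ρ) : η / (η - 1) * (2 * β - π) ≤ π := by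
  obtain ⟨hη1, U, hU, hfU, hUV, hpsh⟩ := hη
  by_contra! hlt
  have hη0 : 0 < η - 1 := by linarith
  have hηp : 0 < η := by linarith
  have hw0 : 0 < 2 * β - π := by linarith
  have hpi := Real.pi_pos
  -- The lower bound on k makes π/(2k) fit in the zero interval of φ; the upper bound says η(k - 1)
  -- < k, leaving room for m.
  obtain ⟨k, hk1, hk2⟩ : ∃ k, max 1 (π / (2 * β - π)) < k ∧ k < η / (η - 1) := by
    refine exists_between (max_lt ?_ ?_)
    · rw [lt_div_iff₀ hη0]; linarith
    · rwa [div_lt_iff₀ hw0]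
  have hk : 1 < k := (le_max_left _ _).trans_lt hk1
  have hkw : π / (2 * β - π) < k := (le_max_right _ _).trans_lt hk1
  have hkη : η * (k - 1) < k := by
    rw [lt_div_iff₀ hη0] at hk2; linarith
  obtain ⟨m, hm1, hm2⟩ := exists_between hkη
  have hm0 : 0 < m := lt_trans (by have : 0 < k - 1 := by linarith
                                   positivity) hm1
  set a := π / (2 * k) with ha
  have ha0 : 0 < a := by positivity
  have hka : k * a = π / 2 := by rw [ha]; field_simp
  have haβ : a ≤ β - π / 2 := by
    rw [div_lt_iff₀ hw0] at hkw
    rw [ha, div_le_iff₀ (by linarith)]; nlinarith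
  have hφ0 : ∀ x, |x| ≤ a → φ x = 0 := fun x hx => h.eq_zero_of_abs_le (hx.trans haβ)
  have hcosk : ∀ x, |x| ≤ a → 0 ≤ Real.cos (k * x) := fun x hx => by
    have : |k * x| ≤ π / 2 := by
      rw [abs_mul, abs_of_pos (by linarith), ← hka]; gcongr
    rw [abs_le] at this
    exact Real.cos_nonneg_of_neg_pi_div_two_le_of_le (by linarith) this.2
  set δ₀ := Real.cos (m * a) with hδ₀
  have hδ₀pos : 0 < δ₀ := by
    have : m * a < π / 2 := by rw [← hka]; gcongr
    exact Real.cos_pos_of_mem_Ioo ⟨by nlinarith [mul_pos hm0 ha0], this⟩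
  have hcosm : ∀ x, |x| ≤ a → δ₀ ≤ Real.cos (m * x) := fun x hx => by
    have h1 : |m * x| ≤ m * a := by rw [abs_mul, abs_of_pos hm0]; gcongr
    rw [← Real.cos_abs (m * x)]
    refine Real.cos_le_cos_of_nonneg_of_le_pi (abs_nonneg _) ?_ h1
    have : m * a < π / 2 := by rw [← hka]; gcongr
    linarith
  let K : Set ℂ := {w | rexp (-a) ≤ ‖w‖ ^ 2 ∧ ‖w‖ ^ 2 ≤ rexp a}
  have hK : ∀ w ∈ K, w ≠ 0 ∧ |Real.log (‖w‖ ^ 2)| ≤ a := fun w hw => by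
    have hpos : 0 < ‖w‖ ^ 2 := (Real.exp_pos _).trans_le hw.1
    refine ⟨fun h0 => by simp [h0] at hpos, abs_le.mpr ⟨?_, ?_⟩⟩
    · exact (Real.le_log_iff_exp_le hpos).mpr hw.1
    · exact (Real.log_le_iff_le_exp hpos).mpr hw.2
  have hfr : ∀ w ∈ K, ((0 : ℂ), w) ∈ frontier (wormDomain φ) := fun w hw =>
    h.mem_frontier_of_norm_eq_one (hK w hw).1 ((hK w hw).2.trans haβ) (by
      rw [zero_sub, norm_neg, mul_comm, Complex.norm_exp_ofReal_mul_I])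
  obtain ⟨δ, hδ, C, hC, hlip⟩ := exists_lipschitz_fst hU (hdef.smooth.mono hUV)
    (isCompact_annulus _ _) fun w hw => hfU (hfr w hw)
  obtain ⟨c, hc, t₀, ht₀, hlin⟩ := h.exists_linear_lower_bound hβ hdef
  -- Half of c^η, so that the final bound at ζ = 0 contradicts ρ(-t, 1) ≥ ct.
  set ε := c ^ η / 2 with hε
  have hcη : 0 < c ^ η := Real.rpow_pos_of_pos hc _
  have hε0 : 0 < ε := by positivity
  -- As m > η(k - 1), cosh(mY) overtakes the growth of ρ^η on the horizontal sides. Y does not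
  -- depend on t.
  obtain ⟨Y, hY0, hY⟩ : ∃ Y > 0, C ^ η * rexp (η * (k - 1) * Y) ≤ ε * (δ₀ * Real.cosh (m * Y)) := by
    have h1 : Filter.Tendsto (fun Y : ℝ => rexp ((m - η * (k - 1)) * Y)) Filter.atTop
        Filter.atTop :=
      Real.tendsto_exp_atTop.comp (Filter.tendsto_id.const_mul_atTop (by linarith))
    obtain ⟨Y, hY1, hY2⟩ := ((h1.eventually_ge_atTop (2 * C ^ η / (ε * δ₀))).and
      (Filter.eventually_gt_atTop 0)).exists
    refine ⟨Y, hY2, ?_⟩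
    rw [div_le_iff₀ (by positivity)] at hY1
    have h2 : rexp (m * Y) = rexp ((m - η * (k - 1)) * Y) * rexp (η * (k - 1) * Y) := by
      rw [← Real.exp_add]; ring_nf
    have h3 : rexp (m * Y) / 2 ≤ Real.cosh (m * Y) := by
      rw [Real.cosh_eq]; have := Real.exp_pos (-(m * Y)); linarith
    calc _ ≤ ε * (δ₀ * (rexp (m * Y) / 2)) := by
          rw [h2]; nlinarith [Real.exp_pos (η * (k - 1) * Y)]
      _ ≤ _ := by gcongr
  set e := rexp ((k - 1) * Y) with he
  have he0 : 0 < e := Real.exp_pos _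
  -- With Y fixed, t is shrunk so that the curve stays in the Lipschitz region and the O(t²) bound
  -- on the vertical sides falls below the majorant.
  obtain ⟨t, ht0, ht⟩ : ∃ t : ℝ, 0 < t ∧ t < t₀ ∧ t * e ≤ 1 ∧ 2 * (t * e) ≤ δ ∧
      C * e ^ 2 * t ≤ (ε * δ₀) ^ η⁻¹ := by
    have hp : 0 < (ε * δ₀) ^ η⁻¹ := Real.rpow_pos_of_pos (by positivity) _
    have hlim : ∀ M : ℝ, ∀ b > 0, ∀ᶠ t in nhdsWithin (0 : ℝ) (Ioi 0), M * t ≤ b := fun M b hb => by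
      have : Filter.Tendsto (fun t : ℝ => M * t) (nhdsWithin 0 (Ioi 0)) (nhds (M * 0)) :=
        ((continuous_const.mul continuous_id).tendsto 0).mono_left nhdsWithin_le_nhds
      exact this.eventually (ge_mem_nhds (by simpa using hb))
    obtain ⟨t, h1, h2, h3, h4, h5⟩ := ((eventually_mem_nhdsWithin (a := (0 : ℝ)) (s := Ioi 0)).and
      ((hlim 2 t₀ ht₀).and ((hlim e 1 one_pos).and ((hlim (2 * e) δ hδ).and
        (hlim (C * e ^ 2) _ hp))))).exists
    have h1' : 0 < t := h1
    exact ⟨t, h1', by linarith, by linarith, by linarith, h5⟩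
  obtain ⟨htt, hte, hteδ, htC⟩ := ht
  have hcv : ∀ ζ : ℂ, |ζ.re| ≤ a → |ζ.im| ≤ Y →
      (wormCurve t k ζ).2 ∈ K ∧ ‖(wormCurve t k ζ).1‖ ≤ t * e := fun ζ h1 h2 => by
    have hx := wormCurve.log_norm_sq_snd t k ζ
    have hpos : 0 < ‖(wormCurve t k ζ).2‖ ^ 2 := by
      have := norm_pos_iff.mpr (wormCurve.snd_ne_zero t k ζ); positivity
    have h1' := abs_le.mp h1
    refine ⟨⟨?_, ?_⟩, ?_⟩
    · exact (Real.le_log_iff_exp_le hpos).mp (by rw [hx]; exact h1'.1)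
    · exact (Real.log_le_iff_le_exp hpos).mp (by rw [hx]; exact h1'.2)
    · rw [wormCurve.norm_fst t k ζ ht0, he]
      have := (abs_le.mp h2).2
      gcongr
  have hte0 : 0 < t * e := by positivity
  have hmaps : ∀ ζ : ℂ, |ζ.re| ≤ a → |ζ.im| ≤ Y →
      wormCurve t k ζ ∈ (closure (wormDomain φ))ᶜ ∩ U := fun ζ h1 h2 => by
    obtain ⟨h3, h4⟩ := hcv ζ h1 h2
    refine ⟨h.notMem_closure ?_, (hlip _ h3 _ (h4.trans (by linarith))).1⟩
    rw [wormCurve.wormFunction_eq _ _ _ (hφ0 _ h1)]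
    have := hcosk _ h1
    positivity
  have hρ0 : ∀ ζ : ℂ, |ζ.re| ≤ a → |ζ.im| ≤ Y → 0 ≤ ρ (wormCurve t k ζ) := fun ζ h1 h2 =>
    hdef.nonneg (hUV (hmaps ζ h1 h2).2) fun h3 => (hmaps ζ h1 h2).1 (subset_closure h3)
  have hbd : ∀ ζ : ℂ, |ζ.re| ≤ a → |ζ.im| ≤ Y → (|ζ.re| = a ∨ |ζ.im| = Y) →
      ρ (wormCurve t k ζ) ^ η ≤
        (ε * t ^ η) * (Real.cos (m * ζ.re) * Real.cosh (m * ζ.im)) := fun ζ h1 h2 h3 => by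
    obtain ⟨hK1, hn⟩ := hcv ζ h1 h2
    have hc1 := hcosm _ h1
    have htη : 0 < t ^ η := Real.rpow_pos_of_pos ht0 _
    rcases h3 with h3 | h3
    · -- the sides: `ρ` is quadratically small there
      obtain ⟨s, hs, hq⟩ : ∃ s : ℝ, |s| = 1 ∧
          -Complex.exp (-(k * ζ.re : ℝ) * Complex.I) = s * Complex.I := by
        have hcase : ζ.re = a ∨ ζ.re = -a := by
          rcases abs_choice ζ.re with h4 | h4 <;> [left; right] <;> linarith
        rcases hcase with h4 | h4
        · refine ⟨1, by simp, ?_⟩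
          rw [h4, hka, ← Complex.ofReal_neg, Complex.exp_mul_I, ← Complex.ofReal_cos,
            ← Complex.ofReal_sin, Real.cos_neg, Real.sin_neg]
          simp
        · refine ⟨-1, by simp, ?_⟩
          rw [h4, mul_neg, hka, ← Complex.ofReal_neg, neg_neg, Complex.exp_mul_I,
            ← Complex.ofReal_cos, ← Complex.ofReal_sin]
          simp
      set T := t * rexp ((k - 1) * ζ.im) with hT
      have hTe : T ≤ t * e := by rw [hT, ← wormCurve.norm_fst t k ζ ht0]; exact hn
      have hT0 : 0 < T := by positivity
      -- On a vertical side the rotated z is ±iT, tangent to the boundary circle at 0, hence within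
      -- T² of a boundary point where ρ = 0.
      obtain ⟨q, hq1, hq2, hq3⟩ := exists_unit_circle_near hT0.le (hTe.trans hte) hs
      have hfst : (wormCurve t k ζ).1 = Complex.exp (ζ.re * Complex.I) * (s * T * Complex.I) := by
        rw [wormCurve.fst_eq, ← mul_neg, hq, mul_comm Complex.I]; ring
      have hfront : (Complex.exp (ζ.re * Complex.I) * q, (wormCurve t k ζ).2) ∈
          frontier (wormDomain φ) := by
        refine h.mem_frontier_of_norm_eq_one (hK _ hK1).1 ((hK _ hK1).2.trans haβ) ?_
        rw [wormCurve.log_norm_sq_snd, mul_comm Complex.I, ← mul_sub_one, norm_mul, hq1,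
          Complex.norm_exp_ofReal_mul_I, one_mul]
      have hl := (hlip _ hK1 (wormCurve t k ζ).1 (hn.trans (by linarith))).2
        (Complex.exp (ζ.re * Complex.I) * q) (by
          rw [norm_mul, Complex.norm_exp_ofReal_mul_I, one_mul]; linarith)
      rw [hdef.eq_zero_of_mem_frontier hfront, sub_zero] at hl
      have hρ : ρ (wormCurve t k ζ) ≤ C * e ^ 2 * t * t := by
        refine (le_abs_self _).trans (hl.trans ?_)
        rw [hfst, ← mul_sub, norm_mul, Complex.norm_exp_ofReal_mul_I, one_mul]
        calc C * ‖(s * T * Complex.I : ℂ) - q‖ ≤ C * T ^ 2 := by gcongr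
          _ ≤ C * (t * e) ^ 2 := by gcongr
          _ = _ := by ring
      calc _ ≤ (C * e ^ 2 * t * t) ^ η := Real.rpow_le_rpow (hρ0 ζ h1 h2) hρ hηp.le
        _ = (C * e ^ 2 * t) ^ η * t ^ η := Real.mul_rpow (by positivity) ht0.le
        _ ≤ ((ε * δ₀) ^ η⁻¹) ^ η * t ^ η := by gcongr
        _ = ε * t ^ η * (δ₀ * 1) := by
          rw [Real.rpow_inv_rpow (by positivity) hηp.ne']; ring
        _ ≤ _ := by
          have := Real.one_le_cosh (m * ζ.im)
          have := hδ₀pos.trans_le hc1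
          gcongr
    · -- the top and the bottom
      have hl := (hlip _ hK1 (wormCurve t k ζ).1 (hn.trans (by linarith))).2 0 (by simpa using hδ.le)
      rw [hdef.eq_zero_of_mem_frontier (hfr _ hK1), sub_zero, sub_zero] at hl
      have hρ : ρ (wormCurve t k ζ) ≤ C * e * t := by
        refine (le_abs_self _).trans (hl.trans ?_)
        calc _ ≤ C * (t * e) := by gcongr
          _ = _ := by ring
      have hcosh : Real.cosh (m * ζ.im) = Real.cosh (m * Y) := by
        rw [← Real.cosh_abs (m * ζ.im), abs_mul, h3, abs_of_pos hm0]
      calc _ ≤ (C * e * t) ^ η := Real.rpow_le_rpow (hρ0 ζ h1 h2) hρ hηp.le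
        _ = C ^ η * rexp (η * (k - 1) * Y) * t ^ η := by
          rw [Real.mul_rpow (by positivity) ht0.le, Real.mul_rpow hC.le he0.le, he,
            ← Real.exp_mul]
          ring_nf
        _ ≤ ε * (δ₀ * Real.cosh (m * Y)) * t ^ η := by gcongr
        _ = ε * t ^ η * (δ₀ * Real.cosh (m * ζ.im)) := by rw [hcosh]; ring
        _ ≤ _ := by gcongr
  have hfin := le_cos_mul_cosh_of_boundary
    (isClosed_closure.isOpen_compl.inter hU) hpsh (wormCurve.hasDerivAt t k)
    (wormCurve.differentiable_deriv t k) (wormCurve.deriv_ne_zero t k) hmaps hbd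
    (ζ := 0) (by simpa using ha0.le) (by simpa using hY0.le)
  have h0 : wormCurve t k 0 = (-(t : ℂ), (1 : ℂ)) := by simp [wormCurve]
  rw [h0] at hfin
  have hl := Real.rpow_le_rpow (by positivity) (hlin t ht0 htt) hηp.le
  rw [Real.mul_rpow hc.le ht0.le] at hl
  simp at hfin
  have htη : 0 < t ^ η := Real.rpow_pos_of_pos ht0 _
  nlinarith [mul_pos hcη htη]

end IsWormProfile

/-! ### Sufficiency: curves adapted to the rotating disc. -/

theorem HasDeriv2.exp_mul {j g : ℝ → ℝ} {A : ℝ} (b : ℝ) (hj : ∀ s, HasDerivAt j (g s) s)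
    (hg : HasDerivAt g A 0) :
    HasDeriv2 (fun s => rexp (b * s) * j s) (b ^ 2 * j 0 + 2 * b * g 0 + A) := by
  have he : ∀ s : ℝ, HasDerivAt (fun s => rexp (b * s)) (rexp (b * s) * b) s := fun s => by
    simpa using ((hasDerivAt_id s).const_mul b).exp
  refine ⟨fun s => rexp (b * s) * (b * j s + g s), .of_forall fun s => ?_, ?_⟩
  · exact ((he s).mul (hj s)).congr_deriv (by ring)
  · refine ((he 0).mul (((hj 0).const_mul b).add hg)).congr_deriv ?_
    simp; ring

theorem HasDeriv2.exp_mul_comp_affine {f : ℝ → ℝ} (hf : ContDiff ℝ ∞ f) (a b x : ℝ) :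
    HasDeriv2 (fun s => rexp (b * s) * f (x + a * s))
      (b ^ 2 * f x + 2 * a * b * deriv f x + a ^ 2 * deriv (deriv f) x) := by
  have hl : ∀ s : ℝ, HasDerivAt (fun s => x + a * s) a s := fun s => by
    simpa using ((hasDerivAt_id s).const_mul a).const_add x
  have hf' : ContDiff ℝ ∞ (deriv f) := (contDiff_infty_iff_deriv.mp hf).2
  have h1 : ∀ s, HasDerivAt (fun s => f (x + a * s)) (deriv f (x + a * s) * a) s := fun s =>
    ((hf.differentiable (by simp) _).hasDerivAt).comp s (hl s)
  have h2 : HasDerivAt (fun s => deriv f (x + a * s) * a) (deriv (deriv f) (x + a * 0) * a * a) 0 :=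
    (((hf'.differentiable (by simp) _).hasDerivAt).comp (0 : ℝ) (hl 0)).mul_const a
  have := HasDeriv2.exp_mul b h1 h2
  simp only [mul_zero, add_zero] at this
  convert this using 1
  ring

/-- A holomorphic curve through `(z, w)` adapted to the worm domain. -/
noncomputable def adaptedCurve (z w c d ζ : ℂ) : ℂ × ℂ :=
  (Complex.exp (2 * Complex.I * c * ζ) * (z + d * ζ), w * Complex.exp (c * ζ))

/-- The derivative of `adaptedCurve`. -/
noncomputable def adaptedCurveDeriv (z w c d ζ : ℂ) : ℂ × ℂ :=
  (Complex.exp (2 * Complex.I * c * ζ) * (2 * Complex.I * c) * (z + d * ζ) +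
    Complex.exp (2 * Complex.I * c * ζ) * d, w * (Complex.exp (c * ζ) * c))

/-- The worm function along `adaptedCurve`, up to an exponential factor. -/
noncomputable def adaptedWorm (φ : ℝ → ℝ) (x : ℝ) (z c d : ℂ) (s : ℝ) : ℝ :=
  rexp (-(2 * c.im) * s) * ‖z + d * s‖ ^ 2
    - 2 * ((z + d * s) * Complex.exp (-(Complex.I * x))).re
    + rexp (2 * c.im * s) * φ (x + 2 * c.re * s)

namespace adaptedCurve

variable (z w c d : ℂ)

theorem hasDerivAt (ζ : ℂ) :
    HasDerivAt (adaptedCurve z w c d) (adaptedCurveDeriv z w c d ζ) ζ := by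
  have hl : ∀ a : ℂ, HasDerivAt (fun ζ : ℂ => a * ζ) a ζ := fun a => by
    simpa using (hasDerivAt_id ζ).const_mul a
  exact HasDerivAt.prodMk ((hl _).cexp.mul ((hl d).const_add z)) ((hl c).cexp.const_mul w)

theorem differentiable_deriv : Differentiable ℂ (adaptedCurveDeriv z w c d) := by
  unfold adaptedCurveDeriv
  fun_prop

theorem apply_zero : adaptedCurve z w c d 0 = (z, w) := by simp [adaptedCurve]

/-- With u = i this turns the imaginary direction into a real one for the parameters (ci, di), so
only real lines need computing. -/
theorem apply_mul (ζ u : ℂ) :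
    adaptedCurve z w c d (ζ * u) = adaptedCurve z w (c * u) (d * u) ζ := by
  simp only [adaptedCurve]; ring_nf

variable {w}

theorem snd_ne_zero (hw : w ≠ 0) (ζ : ℂ) : (adaptedCurve z w c d ζ).2 ≠ 0 :=
  mul_ne_zero hw (Complex.exp_ne_zero _)

theorem log_norm_sq_snd (hw : w ≠ 0) (s : ℝ) :
    Real.log (‖(adaptedCurve z w c d s).2‖ ^ 2) = Real.log (‖w‖ ^ 2) + 2 * c.re * s := by
  rw [adaptedCurve, log_norm_sq_mul_exp hw]
  simp; ring

/-- The argument of exp(2ics) is the angle by which the centre of the disc turns, so the rotation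
drops out; its modulus exp(-2 Im(c) s) is the factor pulled out. -/
theorem wormFunction_eq (φ : ℝ → ℝ) (hw : w ≠ 0) (s : ℝ) :
    wormFunction φ (adaptedCurve z w c d s) =
      rexp (-(2 * c.im * s)) * adaptedWorm φ (Real.log (‖w‖ ^ 2)) z c d s := by
  rw [wormFunction, log_norm_sq_snd _ _ _ hw, adaptedWorm]
  generalize Real.log (‖w‖ ^ 2) = x
  have h1 : (adaptedCurve z w c d s).1 - Complex.exp (Complex.I * (x + 2 * c.re * s : ℝ)) =
      Complex.exp ((x + 2 * c.re * s : ℝ) * Complex.I) *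
        (rexp (-(2 * c.im * s)) * ((z + d * s) * Complex.exp (-(Complex.I * x))) - 1) := by
    have : Complex.exp (2 * Complex.I * c * s) = Complex.exp ((x + 2 * c.re * s : ℝ) * Complex.I) *
        (rexp (-(2 * c.im * s)) * Complex.exp (-(Complex.I * x))) := by
      rw [Complex.ofReal_exp, ← Complex.exp_add, ← Complex.exp_add]
      congr 1
      conv_lhs => rw [← Complex.re_add_im c]
      push_cast
      linear_combination (2 * c.im * s : ℂ) * Complex.I_mul_I
    rw [adaptedCurve, this, mul_comm Complex.I ((x + 2 * c.re * s : ℝ) : ℂ)]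
    ring
  have h2 : ‖z + d * s‖ ^ 2 = ‖(z + d * s) * Complex.exp (-(Complex.I * x))‖ ^ 2 := by
    rw [show -(Complex.I * x) = ((-x : ℝ) : ℂ) * Complex.I by push_cast; ring, norm_mul,
      Complex.norm_exp_ofReal_mul_I, mul_one]
  rw [h1, h2, norm_mul, Complex.norm_exp_ofReal_mul_I, one_mul]
  generalize (z + d * s) * Complex.exp (-(Complex.I * x)) = q
  have h3 : rexp (-(2 * c.im * s)) * rexp (2 * c.im * s) = 1 := by
    rw [← Real.exp_add]; simp
  rw [← Complex.normSq_eq_norm_sq, ← Complex.normSq_eq_norm_sq, Complex.normSq_apply,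
    Complex.normSq_apply, show -(2 * c.im) * s = -(2 * c.im * s) by ring]
  simp only [Complex.sub_re, Complex.sub_im, Complex.re_ofReal_mul, Complex.im_ofReal_mul,
    Complex.one_re, Complex.one_im]
  linear_combination (-φ (x + 2 * c.re * s)) * h3

end adaptedCurve

theorem adaptedWorm_hasDeriv2 {φ : ℝ → ℝ} (hφ : ContDiff ℝ ∞ φ) (x : ℝ) (z c d : ℂ) :
    HasDeriv2 (adaptedWorm φ x z c d)
      ((2 * c.im) ^ 2 * ‖z‖ ^ 2 - 4 * (2 * c.im) * (z.re * d.re + z.im * d.im) + 2 * ‖d‖ ^ 2 +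
        ((2 * c.im) ^ 2 * φ x + 2 * (2 * c.re) * (2 * c.im) * deriv φ x +
          (2 * c.re) ^ 2 * deriv (deriv φ) x)) := by
  have h1 : ∀ s : ℝ, HasDerivAt (fun s : ℝ => ‖z + d * s‖ ^ 2)
      (2 * (z.re * d.re + z.im * d.im) + 2 * s * ‖d‖ ^ 2) s := fun s => by
    have : (fun s : ℝ => ‖z + d * s‖ ^ 2) = fun s : ℝ =>
        ‖z‖ ^ 2 + 2 * (z.re * d.re + z.im * d.im) * s + ‖d‖ ^ 2 * s ^ 2 := by
      funext s
      simp only [← Complex.normSq_eq_norm_sq, Complex.normSq_apply]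
      simp; ring
    rw [this]
    have hs := hasDerivAt_id s
    refine (((hs.const_mul (2 * (z.re * d.re + z.im * d.im))).const_add (‖z‖ ^ 2)).add
      ((hs.pow 2).const_mul (‖d‖ ^ 2))).congr_deriv ?_
    simp; ring
  have h2 : HasDerivAt (fun s : ℝ => 2 * (z.re * d.re + z.im * d.im) + 2 * s * ‖d‖ ^ 2)
      (2 * ‖d‖ ^ 2) 0 := by
    simpa using (((hasDerivAt_id (0 : ℝ)).const_mul 2).mul_const (‖d‖ ^ 2)).const_add
      (2 * (z.re * d.re + z.im * d.im))
  have h3 : HasDeriv2 (fun s : ℝ => 2 * ((z + d * s) * Complex.exp (-(Complex.I * x))).re) 0 := by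
    refine ⟨fun _ => 2 * (d * Complex.exp (-(Complex.I * x))).re, .of_forall fun s => ?_,
      hasDerivAt_const _ _⟩
    have : (fun s : ℝ => 2 * ((z + d * s) * Complex.exp (-(Complex.I * x))).re) = fun s : ℝ =>
        2 * (z * Complex.exp (-(Complex.I * x))).re +
          2 * (d * Complex.exp (-(Complex.I * x))).re * s := by
      funext s
      rw [show (z + d * s) * Complex.exp (-(Complex.I * x)) = z * Complex.exp (-(Complex.I * x)) +
        (s : ℂ) * (d * Complex.exp (-(Complex.I * x))) by ring, Complex.add_re,
        Complex.re_ofReal_mul]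
      ring
    rw [this]
    simpa using ((hasDerivAt_id s).const_mul
      (2 * (d * Complex.exp (-(Complex.I * x))).re)).const_add
        (2 * (z * Complex.exp (-(Complex.I * x))).re)
  have h4 := ((HasDeriv2.exp_mul (-(2 * c.im)) h1 h2).sub h3).add
    (HasDeriv2.exp_mul_comp_affine hφ (2 * c.re) (2 * c.im) x)
  simp only [Complex.ofReal_zero, mul_zero, add_zero, zero_mul, sub_zero] at h4
  unfold adaptedWorm
  convert h4 using 1
  ring

namespace IsWormProfile

variable {β : ℝ} {φ : ℝ → ℝ}

theorem deriv_deriv_nonneg (h : IsWormProfile β φ) (x : ℝ) : 0 ≤ deriv (deriv φ) x := by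
  have hm : MonotoneOn (deriv φ) univ :=
    h.convex.monotoneOn_deriv fun x _ => h.smooth.differentiable (by simp) x
  exact (monotoneOn_univ.mp hm).deriv_nonneg

theorem pos_of_lt (h : IsWormProfile β φ) {x : ℝ} (hx : β - π / 2 < x) : 0 < φ x := by
  refine lt_of_le_of_ne (h.nonneg x) fun h0 => ?_
  have : x ∈ φ ⁻¹' {0} := h0.symm
  rw [h.zero_set] at this
  exact absurd this.2 (not_le.mpr hx)

/-- Convexity on the segment from 0 to |x|, with φ(0) = 0, gives φ(l) ≤ (l/|x|) φ(x). -/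
theorem le_of_le_abs (h : IsWormProfile β φ) (hβ : π / 2 < β) {l x : ℝ} (hl : 0 < l)
    (hx : l ≤ |x|) : φ l ≤ φ x := by
  have hφx : φ |x| = φ x := by
    rcases abs_choice x with h1 | h1 <;> rw [h1]
    exact h.even x
  have h0 : φ 0 = 0 := by
    have : (0 : ℝ) ∈ φ ⁻¹' {0} := by rw [h.zero_set]; constructor <;> linarith
    exact this
  have hpos : 0 < |x| := hl.trans_le hx
  have hq : l / |x| ≤ 1 := (div_le_one hpos).mpr hx
  have h1 := h.convex.2 (mem_univ |x|) (mem_univ 0) (show 0 ≤ l / |x| by positivity)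
    (show 0 ≤ 1 - l / |x| by linarith) (by ring)
  simp only [smul_eq_mul, mul_zero, add_zero, h0, div_mul_cancel₀ _ hpos.ne', hφx] at h1
  exact h1.trans (mul_le_of_le_one_left (h.nonneg x) hq)

end IsWormProfile

/-! ### Sufficiency: the twisted defining function. -/

/-- The worm function multiplied by `τ (log |w|²) ^ (-1 / κ)`. -/
noncomputable def twistedWorm (φ τ : ℝ → ℝ) (κ : ℝ) (p : ℂ × ℂ) : ℝ :=
  wormFunction φ p * τ (Real.log (‖p.2‖ ^ 2)) ^ (-(1 / κ))

theorem contDiffAt_twistedWorm {φ τ : ℝ → ℝ} (hφ : ContDiff ℝ ∞ φ) (hτ : ContDiff ℝ ∞ τ)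
    (hτ0 : ∀ x, 0 < τ x) (κ : ℝ) {p : ℂ × ℂ} (hp : p.2 ≠ 0) :
    ContDiffAt ℝ ∞ (twistedWorm φ τ κ) p :=
  (contDiffAt_wormFunction hφ hp).mul
    ((hτ.contDiffAt.comp p (contDiffAt_log_norm_sq hp)).rpow_const_of_ne (hτ0 _).ne')

theorem isDefiningFunction_twistedWorm {β : ℝ} {φ τ : ℝ → ℝ} (h : IsWormProfile β φ)
    (hτ : ContDiff ℝ ∞ τ) (hτ0 : ∀ x, 0 < τ x) (κ : ℝ) :
    IsDefiningFunction (wormDomain φ) {p | p.2 ≠ 0} (twistedWorm φ τ κ) where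
  isOpen := isOpen_snd_ne_zero
  closure_subset := fun _ hp => (h.closure_subset hp).1
  smooth := fun _ hp => (contDiffAt_twistedWorm h.smooth hτ hτ0 κ hp).contDiffWithinAt
  eq_neg := by
    ext p
    have := Real.rpow_pos_of_pos (hτ0 (Real.log (‖p.2‖ ^ 2))) (-(1 / κ))
    refine and_congr_right fun _ => ?_
    rw [twistedWorm, mul_neg_iff]
    constructor
    · exact fun h => Or.inr ⟨h, this⟩
    · rintro (h | h)
      · exact absurd this h.2.not_gt
      · exact h.1
  fderiv_ne_zero := fun p hp => by
    obtain ⟨hp2, hr⟩ := h.mem_frontier_iff.mp hp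
    have h1 := ((contDiffAt_wormFunction h.smooth hp2).differentiableAt (by simp)).hasFDerivAt
    have hc : ContDiffAt ℝ ∞ (fun p : ℂ × ℂ => τ (Real.log (‖p.2‖ ^ 2)) ^ (-(1 / κ))) p :=
      (hτ.contDiffAt.comp p (contDiffAt_log_norm_sq hp2)).rpow_const_of_ne (hτ0 _).ne'
    have h2 := (hc.differentiableAt (by simp)).hasFDerivAt
    have h3 : HasFDerivAt (twistedWorm φ τ κ) _ p := h1.mul h2
    rw [h3.fderiv, hr, zero_smul, zero_add]
    exact smul_ne_zero (Real.rpow_pos_of_pos (hτ0 _) _).ne'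
      (fderiv_wormFunction_ne_zero h.smooth h.deriv_ne_zero hp2 hr)

/-- Where the worm function `r` is positive and `r (κ² τ + τ'') < κ τ (φ + φ'')`, the power `η` of
the twisted worm function has positive Levi form. -/
theorem leviForm_twistedWorm_pos {φ τ : ℝ → ℝ} (hφ : ContDiff ℝ ∞ φ) (hτ : ContDiff ℝ ∞ τ)
    (hτ0 : ∀ x, 0 < τ x) {η κ : ℝ} (hη : 1 < η) (hκ : κ = η / (η - 1)) {p v : ℂ × ℂ}
    (hp : p.2 ≠ 0) (hr : 0 < wormFunction φ p) (hv : v ≠ 0)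
    (hkey : wormFunction φ p * (κ ^ 2 * τ (Real.log (‖p.2‖ ^ 2)) +
        deriv (deriv τ) (Real.log (‖p.2‖ ^ 2))) <
      κ * τ (Real.log (‖p.2‖ ^ 2)) * (φ (Real.log (‖p.2‖ ^ 2)) +
        deriv (deriv φ) (Real.log (‖p.2‖ ^ 2)))) :
    0 < leviForm (fun p => twistedWorm φ τ κ p ^ η) p v := by
  obtain ⟨z, w⟩ := p
  obtain ⟨v₁, v₂⟩ := v
  simp only at hp hkey
  set x := Real.log (‖w‖ ^ 2) with hx
  have hη1 : 0 < η - 1 := by linarith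
  have hη0 : 0 < η := by linarith
  have hκ0 : 0 < κ := by rw [hκ]; positivity
  have hκη : κ * (η - 1) = η := by rw [hκ]; field_simp
  have hκη' : -(1 / κ) * η = 1 - η := by rw [hκ]; field_simp; ring
  obtain ⟨c, hc⟩ : ∃ c, w * c = v₂ := ⟨v₂ / w, by field_simp⟩
  obtain ⟨d, hd⟩ : ∃ d, 2 * Complex.I * c * z + d = v₁ := ⟨v₁ - 2 * Complex.I * c * z, by ring⟩
  have hv' : adaptedCurveDeriv z w c d 0 = (v₁, v₂) := by
    simp [adaptedCurveDeriv, ← hc, ← hd]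
  have hsmooth : ContDiffAt ℝ 2 (fun p => twistedWorm φ τ κ p ^ η) (adaptedCurve z w c d 0) := by
    rw [adaptedCurve.apply_zero]
    refine (contDiffAt_infty.mp
      (contDiffAt_twistedWorm hφ hτ hτ0 κ (p := (z, w)) hp) 2).rpow_const_of_ne ?_
    exact (mul_pos hr (Real.rpow_pos_of_pos (hτ0 _) _)).ne'
  obtain ⟨A, B, hA, hB, hAB⟩ := leviForm_eq_along_curve hsmooth (adaptedCurve.hasDerivAt z w c d)
    (adaptedCurve.differentiable_deriv z w c d 0).hasDerivAt
  rw [hv', adaptedCurve.apply_zero] at hAB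
  have hR0 : ∀ c d : ℂ, adaptedWorm φ x z c d 0 = wormFunction φ (z, w) := fun c d => by
    have := adaptedCurve.wormFunction_eq z c d φ hp 0
    rw [Complex.ofReal_zero, adaptedCurve.apply_zero] at this
    rw [mul_zero, neg_zero, Real.exp_zero, one_mul] at this
    exact this.symm
  have hline : ∀ c d : ℂ, ∃ A, HasDeriv2
      (fun s : ℝ => twistedWorm φ τ κ (adaptedCurve z w c d s) ^ η) A ∧
      η * wormFunction φ (z, w) ^ (η - 1) * τ x ^ (1 - η) *
        ((2 * c.im) ^ 2 * ‖z‖ ^ 2 - 4 * (2 * c.im) * (z.re * d.re + z.im * d.im) + 2 * ‖d‖ ^ 2 +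
        ((2 * c.im) ^ 2 * φ x + 2 * (2 * c.re) * (2 * c.im) * deriv φ x +
          (2 * c.re) ^ 2 * deriv (deriv φ) x)) -
      (η - 1) * wormFunction φ (z, w) ^ η * τ x ^ (-η) *
        ((κ * (2 * c.im)) ^ 2 * τ x + 2 * (2 * c.re) * (κ * (2 * c.im)) * deriv τ x +
          (2 * c.re) ^ 2 * deriv (deriv τ) x) ≤ A := fun c d => by
    obtain ⟨A, hA, hA'⟩ := HasDeriv2.perspective hη (adaptedWorm_hasDeriv2 hφ x z c d)
      (HasDeriv2.exp_mul_comp_affine hτ (2 * c.re) (κ * (2 * c.im)) x)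
      (by rw [hR0]; exact hr) (by simpa using hτ0 x)
    simp only [hR0, mul_zero, add_zero, Real.exp_zero, one_mul] at hA'
    refine ⟨A, hA.congr ?_, hA'⟩
    obtain ⟨g, hg, -⟩ := adaptedWorm_hasDeriv2 hφ x z c d
    filter_upwards [hg.self_of_nhds.continuousAt.eventually
      (lt_mem_nhds (show 0 < adaptedWorm φ x z c d 0 by rw [hR0]; exact hr))] with s hs
    rw [twistedWorm, adaptedCurve.wormFunction_eq _ _ _ _ hp, adaptedCurve.log_norm_sq_snd _ _ _ hp,
      ← hx, Real.mul_rpow (by positivity) (Real.rpow_nonneg (hτ0 _).le _),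
      Real.mul_rpow (Real.exp_pos _).le hs.le, Real.mul_rpow (Real.exp_pos _).le (hτ0 _).le,
      ← Real.rpow_mul (hτ0 _).le, hκη', ← Real.exp_mul, ← Real.exp_mul]
    -- Since κ(1 - η) = -η, the exponential factor of the worm function can be moved into the second
    -- argument as exp(2κ Im(c) s) τ.
    have : -(2 * c.im * s) * η = κ * (2 * c.im) * s * (1 - η) := by
      linear_combination (2 * c.im * s) * hκη
    rw [this]; ring
  obtain ⟨A', hA', hle⟩ := hline c d
  obtain ⟨B', hB', hle'⟩ := hline (c * Complex.I) (d * Complex.I)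
  obtain rfl : A = A' := hA.unique (by simpa using hA')
  obtain rfl : B = B' := hB.unique (by simpa [adaptedCurve.apply_mul] using hB')
  have hrτ : 0 < wormFunction φ (z, w) ^ (η - 1) * τ x ^ (-η) :=
    mul_pos (Real.rpow_pos_of_pos hr _) (Real.rpow_pos_of_pos (hτ0 _) _)
  have e1 : wormFunction φ (z, w) ^ η = wormFunction φ (z, w) ^ (η - 1) * wormFunction φ (z, w) := by
    rw [← Real.rpow_add_one hr.ne']; ring_nf
  have e2 : τ x ^ (1 - η) = τ x ^ (-η) * τ x := by
    rw [← Real.rpow_add_one (hτ0 _).ne']; ring_nf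
  set r := wormFunction φ (z, w) with hrdef
  set q := r ^ (η - 1) * τ x ^ (-η) with hq
  -- Adding the lines (c, d) and (ci, di) cancels the terms in φ' and τ', and the terms in z and d
  -- complete a square.
  have hsum : q * (η - 1) * (κ * τ x * ‖2 * d + 2 * Complex.I * c * z‖ ^ 2 + 4 * ‖c‖ ^ 2 *
      (κ * τ x * (φ x + deriv (deriv φ) x) - r * (κ ^ 2 * τ x + deriv (deriv τ) x))) ≤ A + B := by
    refine le_trans (le_of_eq ?_) (add_le_add hle hle')
    rw [e1, e2]
    have hd2 : ‖d * Complex.I‖ ^ 2 = ‖d‖ ^ 2 := by simp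
    rw [hd2]
    simp only [← Complex.normSq_eq_norm_sq, Complex.normSq_apply]
    simp only [Complex.mul_re, Complex.mul_im, Complex.add_re, Complex.add_im, Complex.I_re,
      Complex.I_im, Complex.re_ofNat, Complex.im_ofNat]
    rw [show η * (r ^ (η - 1)) = (η - 1) * (κ * r ^ (η - 1)) by
      linear_combination (-r ^ (η - 1)) * hκη, hq]
    ring
  have hτx := hτ0 x
  have hpos : 0 < κ * τ x * ‖2 * d + 2 * Complex.I * c * z‖ ^ 2 + 4 * ‖c‖ ^ 2 *
      (κ * τ x * (φ x + deriv (deriv φ) x) - r * (κ ^ 2 * τ x + deriv (deriv τ) x)) := by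
    have hk := sub_pos.mpr hkey
    by_cases hc0 : c = 0
    · have hd0 : d ≠ 0 := by
        rintro rfl
        exact hv (by simp [← hc, ← hd, hc0])
      have : 0 < ‖d‖ := norm_pos_iff.mpr hd0
      simp only [hc0, mul_zero, zero_mul, add_zero, norm_zero, norm_mul, Complex.norm_ofNat]
      positivity
    · have : 0 < ‖c‖ := norm_pos_iff.mpr hc0
      exact add_pos_of_nonneg_of_pos (by positivity) (mul_pos (by positivity) hk)
  have : 0 < A + B := lt_of_lt_of_le (mul_pos (mul_pos hrτ hη1) hpos) hsum
  linarith

namespace IsWormProfile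

variable {β : ℝ} {φ : ℝ → ℝ}

theorem exists_mem_steinExponents (h : IsWormProfile β φ) (hβ : π / 2 < β) {η : ℝ} (hη : 1 < η)
    (hlt : η / (η - 1) * (2 * β - π) < π) :
    ∃ V ρ, IsDefiningFunction (wormDomain φ) V ρ ∧ η ∈ steinExponents (wormDomain φ) V ρ := by
  have hη1 : 0 < η - 1 := by linarith
  have hw0 : 0 < 2 * β - π := by linarith
  have hpi := Real.pi_pos
  obtain ⟨κ, hκ⟩ : ∃ κ, κ = η / (η - 1) := ⟨_, rfl⟩
  have hκ0 : 0 < κ := by rw [hκ]; positivity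
  -- With κ₁ > κ, cos(κ₁x) satisfies τ'' < -κ²τ wherever it is positive; κ₁ < π/(2β - π) puts its
  -- first zero l beyond the zero interval of φ.
  obtain ⟨κ₁, hκ₁, hκ₁'⟩ : ∃ κ₁, κ < κ₁ ∧ κ₁ < π / (2 * β - π) := by
    refine exists_between ?_
    rwa [lt_div_iff₀ hw0, hκ]
  have hκ₁0 : 0 < κ₁ := hκ0.trans hκ₁
  set l := π / (2 * κ₁) with hl
  have hl0 : 0 < l := by positivity
  have hlκ : κ₁ * l = π / 2 := by rw [hl]; field_simp
  have hlβ : β - π / 2 < l := by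
    rw [lt_div_iff₀ hw0] at hκ₁'
    rw [hl, lt_div_iff₀ (by positivity)]; nlinarith
  have hφl := h.pos_of_lt hlβ
  -- Nφ ≥ 2 for |x| ≥ l outweighs the cosine, which is at least -1.
  obtain ⟨N, hN, hN2⟩ : ∃ N, 0 < N ∧ N * φ l = 2 := ⟨2 / φ l, by positivity, by field_simp⟩
  let τ : ℝ → ℝ := fun x => Real.cos (κ₁ * x) + N * φ x
  have hcos : ∀ x, |x| < l → 0 < Real.cos (κ₁ * x) := fun x hx => by
    have : |κ₁ * x| < π / 2 := by
      rw [abs_mul, abs_of_pos hκ₁0, ← hlκ]; gcongr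
    exact Real.cos_pos_of_mem_Ioo (abs_lt.mp this)
  have hNφ : ∀ x, l ≤ |x| → 2 ≤ N * φ x := fun x hx => by
    rw [← hN2]; gcongr; exact h.le_of_le_abs hβ hl0 hx
  have hτ0 : ∀ x, 0 < τ x := fun x => by
    rcases lt_or_ge |x| l with hx | hx
    · exact add_pos_of_pos_of_nonneg (hcos x hx) (mul_nonneg hN.le (h.nonneg x))
    · have := hNφ x hx
      have := Real.neg_one_le_cos (κ₁ * x)
      simp only [τ]; linarith
  have hτ : ContDiff ℝ ∞ τ :=
    (Real.contDiff_cos.comp (contDiff_const.mul contDiff_id)).add (contDiff_const.mul h.smooth)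
  have hτ2 : ∀ x, deriv (deriv τ) x = -(κ₁ ^ 2 * Real.cos (κ₁ * x)) + N * deriv (deriv φ) x := by
    intro x
    have hlin : ∀ x : ℝ, HasDerivAt (fun x => κ₁ * x) κ₁ x := fun x => by
      simpa using (hasDerivAt_id x).const_mul κ₁
    have h1 : deriv τ = fun x => -Real.sin (κ₁ * x) * κ₁ + N * deriv φ x := by
      funext y
      exact ((hlin y).cos.add
        ((h.smooth.differentiable (by simp) y).hasDerivAt.const_mul N)).deriv
    have h2 : ContDiff ℝ ∞ (deriv φ) := (contDiff_infty_iff_deriv.mp h.smooth).2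
    rw [h1]
    refine HasDerivAt.deriv ((((hlin x).sin.neg.mul_const κ₁).add
      ((h2.differentiable (by simp) x).hasDerivAt.const_mul N)).congr_deriv ?_)
    ring
  have hdef := isDefiningFunction_twistedWorm h hτ hτ0 κ
  -- The part N(κ² + 1) handles the contribution of Nφ; Nκ₁² handles the cosine where it may be
  -- negative, that is |x| ≥ l, using N(φ + φ'') ≥ 1.
  set M := N * (κ ^ 2 + 1 + κ₁ ^ 2) with hM
  have hkey : ∀ x r, 0 < r → M * r < κ * τ x →
      r * (κ ^ 2 * τ x + deriv (deriv τ) x) < κ * τ x * (φ x + deriv (deriv φ) x) := by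
    intro x r hr hMr
    have hφ0 := h.nonneg x
    have hφ2 := h.deriv_deriv_nonneg x
    have hg : 0 ≤ φ x + deriv (deriv φ) x := by positivity
    have h0 : κ ^ 2 * τ x + deriv (deriv τ) x = -((κ₁ ^ 2 - κ ^ 2) * Real.cos (κ₁ * x)) +
        N * (κ ^ 2 * φ x + deriv (deriv φ) x) := by
      rw [hτ2]; simp only [τ]; ring
    have h1 : N * (κ ^ 2 * φ x + deriv (deriv φ) x) ≤
        N * ((κ ^ 2 + 1) * (φ x + deriv (deriv φ) x)) := by
      gcongr
      nlinarith [mul_nonneg (sq_nonneg κ) hφ2]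
    have hκκ : 0 < κ₁ ^ 2 - κ ^ 2 := by nlinarith
    have h3 : M * r * (φ x + deriv (deriv φ) x) ≤ κ * τ x * (φ x + deriv (deriv φ) x) := by
      gcongr
    rw [h0]
    rcases lt_or_ge |x| l with hx | hx
    · have hcx := mul_pos hκκ (hcos x hx)
      have h4 : -((κ₁ ^ 2 - κ ^ 2) * Real.cos (κ₁ * x)) +
          N * (κ ^ 2 * φ x + deriv (deriv φ) x) < M * (φ x + deriv (deriv φ) x) := by
        have : 0 ≤ N * (κ₁ ^ 2 * (φ x + deriv (deriv φ) x)) := by positivity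
        rw [hM]; linarith
      have := mul_lt_mul_of_pos_left h4 hr
      linarith
    · have hN2x := hNφ x hx
      have hφpos : 0 < φ x := by
        by_contra! hneg
        nlinarith
      have hg' : 0 < φ x + deriv (deriv φ) x := by positivity
      have h4 : -((κ₁ ^ 2 - κ ^ 2) * Real.cos (κ₁ * x)) +
          N * (κ ^ 2 * φ x + deriv (deriv φ) x) ≤ M * (φ x + deriv (deriv φ) x) := by
        have h5 : -((κ₁ ^ 2 - κ ^ 2) * Real.cos (κ₁ * x)) ≤ κ₁ ^ 2 := by
          nlinarith [Real.neg_one_le_cos (κ₁ * x), sq_nonneg κ]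
        have h6 : κ₁ ^ 2 ≤ κ₁ ^ 2 * (N * (φ x + deriv (deriv φ) x)) := by
          have : 1 ≤ N * (φ x + deriv (deriv φ) x) := by
            have := mul_nonneg hN.le hφ2
            linarith
          exact le_mul_of_one_le_right (by positivity) this
        rw [hM]; linarith
      calc _ ≤ r * (M * (φ x + deriv (deriv φ) x)) := by gcongr
        _ = M * r * (φ x + deriv (deriv φ) x) := by ring
        _ < _ := by gcongr
  -- The condition Mr < κτ defines a neighbourhood of the boundary, because r = 0 < τ there.
  refine ⟨_, _, hdef, hη, {p | p.2 ≠ 0} ∩ {p | p.2 ≠ 0 ∧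
    M * wormFunction φ p < κ * τ (Real.log (‖p.2‖ ^ 2))}, ?_, ?_, inter_subset_left, ?_⟩
  · rw [isOpen_iff_mem_nhds]
    rintro p ⟨hp, -, hr⟩
    have hc1 := continuousAt_wormFunction h.smooth hp
    have hc2 : ContinuousAt (fun p : ℂ × ℂ => τ (Real.log (‖p.2‖ ^ 2))) p :=
      (hτ.contDiffAt.comp p (contDiffAt_log_norm_sq hp)).continuousAt
    filter_upwards [isOpen_snd_ne_zero.mem_nhds hp,
      (hc1.const_mul M).eventually_lt (hc2.const_mul κ) hr] with q h1 h2 using ⟨h1, h1, h2⟩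
  · intro p hp
    obtain ⟨h1, h2⟩ := h.mem_frontier_iff.mp hp
    refine ⟨h1, h1, ?_⟩
    rw [h2, mul_zero]
    exact mul_pos hκ0 (hτ0 _)
  · refine ⟨?_, ?_⟩
    · rintro p ⟨hcl, hp, -⟩
      have hr := h.wormFunction_pos hp hcl
      refine ContDiffAt.contDiffWithinAt ((contDiffAt_infty.mp
        (contDiffAt_twistedWorm h.smooth hτ hτ0 κ hp) 2).rpow_const_of_ne ?_)
      exact (mul_pos hr (Real.rpow_pos_of_pos (hτ0 _) _)).ne'
    · rintro p ⟨hcl, hp, -, hMr⟩ v hv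
      have hr := h.wormFunction_pos hp hcl
      exact leviForm_twistedWorm_pos h.smooth hτ hτ0 hη hκ hp hr hv (hkey _ _ hr hMr)

end IsWormProfile

/-! ### The Steinness index. -/

theorem theorem5p3 (β : ℝ) (hβ : π / 2 < β) (φ : ℝ → ℝ) (hφ : IsWormProfile β φ) :
    (β < π → steinnessIndex (wormDomain φ) = ((π / (2 * (π - β)) : ℝ) : EReal)) ∧
    (π ≤ β → steinnessIndex (wormDomain φ) = ⊤) := by
  have hpi := Real.pi_pos
  refine ⟨fun hlt => le_antisymm ?_ ?_, fun hle => ?_⟩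
  · refine EReal.le_of_forall_lt_iff_le.mp fun η hη => ?_
    have hη' : π / (2 * (π - β)) < η := by exact_mod_cast hη
    have h2 : 0 < 2 * (π - β) := by linarith
    have h1 : 1 < π / (2 * (π - β)) := by rw [lt_div_iff₀ h2]; linarith
    have hη1 : 1 < η := h1.trans hη'
    rw [div_lt_iff₀ h2] at hη'
    obtain ⟨V, ρ, hdef, hmem⟩ := hφ.exists_mem_steinExponents hβ hη1 (by
      rw [div_mul_eq_mul_div, div_lt_iff₀ (by linarith)]; nlinarith)
    calc steinnessIndex (wormDomain φ) ≤ steinnessExponent (wormDomain φ) V ρ :=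
          sInf_le ⟨V, ρ, hdef, rfl⟩
      _ ≤ η := sInf_le (mem_image_of_mem _ hmem)
  · refine le_sInf ?_
    rintro _ ⟨V, ρ, hdef, rfl⟩
    refine le_sInf ?_
    rintro _ ⟨η, hη, rfl⟩
    have hc := hφ.exponent_mul_width_le hβ hdef hη
    have hη1 : 0 < η - 1 := by linarith [hη.1]
    rw [div_mul_eq_mul_div, div_le_iff₀ hη1] at hc
    have : π / (2 * (π - β)) ≤ η := by
      rw [div_le_iff₀ (by linarith)]; nlinarith
    exact EReal.coe_le_coe_iff.mpr this
  · refine sInf_eq_top.mpr ?_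
    rintro _ ⟨V, ρ, hdef, rfl⟩
    have hempty : steinExponents (wormDomain φ) V ρ = ∅ := by
      refine eq_empty_of_forall_notMem fun η hη => ?_
      have hc := hφ.exponent_mul_width_le hβ hdef hη
      have hη1 : 0 < η - 1 := by linarith [hη.1]
      rw [div_mul_eq_mul_div, div_le_iff₀ hη1] at hc
      -- Here 2β - π ≥ π, so the bound would give ηπ ≤ (η - 1)π.
      nlinarith [hη.1]
    rw [steinnessExponent, hempty, image_empty, _root_.sInf_empty]
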